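/- **Setting.** A network is a simple undirected graph $G=(V,E)$ with $n=|V|$ nodes. Computation is in the synchronous CONGEST model: in each round each node may send to each of its neighbours a message of at most $b\lceil\log_2 n\rceil$ bits, where $b$ is a constant; local computation is free, nodes have private random coins, and an algorithm is designed for a given network (the nodes have distinct identities and know the network) and a given sparsity parameter $k$, but not for a given input. Delivering a set of messages within $T$ rounds means moving each message from its origin along edges of the graph to a permitted destination, where each edge carries at most one message per round in each direction. Let $V=\mathcal C\sqcup\mathcal P$ be a partition into a core and a periphery. $G(V,E,\mathcal C,\mathcal P)$ is a *core-periphery network* with constants $(\alpha,\beta,\gamma)$ if * every $v\in\mathcal C$ satisfies $\dfrac{|N(v)\setminus\mathcal C|}{|N(v)\cap\mathcal C|+1}\le\alpha$; * in the graph induced on $\mathcal C$, one message from $v$ to $w$ for every ordered pair of distinct $v,w\in\mathcal C$ can all be delivered within $\beta$ rounds; * in $G$, one message from each $v\in\mathcal P$ can be delivered, each to some node of $\mathcal C$, within $\gamma$ rounds. An $n\times n$ matrix is *$s$-sparse* if each of its rows and each of its columns has at most $s$ nonzero entries. In the *matrix multiplication task*, for $s$-sparse integer matrices $A,B$ whose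 entries have absolute value at most $n^{e}$ (so each fits in $O(\log n)$ bits), each node initially holds one row of $A$ and one row of $B$, together with their indices, the assignment of rows to nodes being arbitrary (two bijections); at the end, the node that initially held row $i$ of $B$ must hold row $i$ of $AB$. **Theorem.** 1. (Upper bound.) For all constants $\alpha,\beta,\gamma$, $c$, $e$, $a$ there are constants $b$ and $K$ such that, for every core-periphery network with constants $(\alpha,\beta,\gamma)$ on any number $n$ of nodes and every $k\ge 1$, there is a randomized CONGEST algorithm with messages of $b\lceil\log_2 n\rceil$ bits which, for all $ck$-sparse matrices $A,B$ with entries at most $n^e$ in absolute value and every distribution of their rows, completes the matrix multiplication task within $Kk^2$ rounds with probability at least $1-n^{-a}$. 2. (Matching lower bound.) There are constants $\alpha,\beta,\gamma$ such that for every $b$ there is $\delta>0$ with the following property. For every $n\ge 2$ there is a core-periphery network with constants $(\alpha,\beta,\gamma)$ on $n$ nodes such that, for all $k\ge1$ with $k^2\le n$ and all $e\ge 1$, every randomized CONGEST algorithm with messages of $b\lceil\log_2 n\rceil$ bits that completes the matrix multiplication task within $T$ rounds with probability at least $1/2$, for all $k$-sparse $A,B$ with entries at most $n^e$ in absolute value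 and every distribution of their rows, has $T\ge\delta k^2$. -/

import Mathlib

namespace CorePeriphery

/-! ## Delivering messages, and core-periphery networks -/

/-- It is possible to deliver the messages `i : ι`, where message `i` originates at the node
`src i` and has to reach some node of `dest i`, within `T` synchronous rounds on the network `G`.
Here `pos i t` is the node that holds message `i` after `t` rounds. In each round a message stays
where it is or crosses one edge, and each edge carries at most one message per round in each of
its two directions. -/
def CanDeliver {V ι : Type} (G : SimpleGraph V) (src : ι → V) (dest : ι → Set V) (T : ℕ) : Prop :=
  ∃ pos : ι → ℕ → V,
    (∀ i, pos i 0 = src i) ∧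
    (∀ i, pos i T ∈ dest i) ∧
    (∀ i, ∀ t < T, pos i (t + 1) = pos i t ∨ G.Adj (pos i t) (pos i (t + 1))) ∧
    (∀ i j, ∀ t < T, pos i t = pos j t → pos i (t + 1) = pos j (t + 1) →
      pos i (t + 1) ≠ pos i t → i = j)

/-- `S` has an `α`-balanced boundary in `G`: every `v ∈ S` satisfies
`d_out(v, S) / (d_in(v, S) + 1) ≤ α`. -/
def HasBalancedBoundary {V : Type} (G : SimpleGraph V) (S : Set V) (α : ℝ) : Prop :=
  ∀ v ∈ S, ((G.neighborSet v \ S).ncard : ℝ) / ((G.neighborSet v ∩ S).ncard + 1) ≤ α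

/-- `G` is a `β`-clique-emulator: one message for each ordered pair of distinct nodes `(v, w)`,
from `v` to `w`, can be delivered within `β` rounds. -/
def IsCliqueEmulator {V : Type} (G : SimpleGraph V) (β : ℕ) : Prop :=
  CanDeliver (ι := {p : V × V // p.1 ≠ p.2}) G (fun p => p.1.1) (fun p => {p.1.2}) β

/-- `S` and `T` form a `γ`-convergecaster in `G`: one message from each node of `S` can be
delivered, each to some node of `T`, within `γ` rounds. -/
def IsConvergecaster {V : Type} (G : SimpleGraph V) (S T : Set V) (γ : ℕ) : Prop :=
  CanDeliver (ι := S) G (fun v => (v : V)) (fun _ => T) γ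

/-- The network `G`, partitioned into the core `C` and the periphery `Cᶜ`, is a core-periphery
network, with constants `α`, `β`, `γ` in the three axioms. -/
structure IsCPNetwork {V : Type} (G : SimpleGraph V) (C : Set V) (α : ℝ) (β γ : ℕ) : Prop where
  boundary : HasBalancedBoundary G C α
  cliqueEmulation : IsCliqueEmulator (G.induce C) β
  convergecast : IsConvergecaster G Cᶜ C γ

/-! ## The synchronous CONGEST model with private coins -/

/-- What may be sent over an edge, in one direction, in one round: nothing, or `w` bits. -/
abbrev Message (w : ℕ) : Type := Option (Fin w → Bool)

/-- A randomized distributed algorithm for a network with node set `V`, with messages of `w` bits.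
All functions take the node as an argument: the nodes have distinct identities and know the
network. Local computation is not restricted. -/
structure CongestAlgorithm (V Input Output : Type) (w : ℕ) where
  /-- The private random seed of a node is a uniformly random element of this type. -/
  Coin : Type
  [finiteCoin : Finite Coin]
  [nonemptyCoin : Nonempty Coin]
  State : Type
  /-- The initial state of a node, from its local input and its private random seed. -/
  init : V → Input → Coin → State
  /-- `send v s u` is what the node `v`, in state `s`, sends to its neighbour `u`. -/
  send : V → State → V → Message w
  /-- `step v s m` is the next state of `v` if it is in state `s` and receives `m u` from `u`. -/
  step : V → State → (V → Message w) → State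
  /-- What a node in a given state presents as its output. -/
  output : V → State → Output

namespace CongestAlgorithm

variable {V Input Output : Type} {w : ℕ}

open Classical in
/-- The states of all nodes after `t` rounds on `G`, given the local inputs and the seeds. -/
noncomputable def run (alg : CongestAlgorithm V Input Output w) (G : SimpleGraph V)
    (input : V → Input) (coin : V → alg.Coin) : ℕ → V → alg.State
  | 0 => fun v => alg.init v (input v) (coin v)
  | t + 1 => fun v =>
      alg.step v (alg.run G input coin t v) fun u =>
        if G.Adj u v then alg.send u (alg.run G input coin t u) v else none

/-- The probability, over independent uniform private seeds, that after `T` rounds every node `v`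
presents the output `target v`. -/
noncomputable def successProb (alg : CongestAlgorithm V Input Output w) (G : SimpleGraph V)
    (input : V → Input) (target : V → Output) (T : ℕ) : ℝ :=
  (Nat.card {coin : V → alg.Coin // ∀ v, alg.output v (alg.run G input coin T v) = target v} : ℝ) /
    (Nat.card (V → alg.Coin) : ℝ)

end CongestAlgorithm

/-! ## Multiplication of sparse matrices -/

/-- Each row and each column of `A` has at most `s` nonzero entries. -/
def IsSparse {n : ℕ} (A : Matrix (Fin n) (Fin n) ℤ) (s : ℕ) : Prop :=
  (∀ i, {j | A i j ≠ 0}.ncard ≤ s) ∧ (∀ j, {i | A i j ≠ 0}.ncard ≤ s)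

/-- The entries of `A` are at most `n ^ e` in absolute value, so that they can be represented by
`O(e log n)` bits. -/
def HasSmallEntries {n : ℕ} (A : Matrix (Fin n) (Fin n) ℤ) (e : ℕ) : Prop :=
  ∀ i j, |A i j| ≤ (n : ℤ) ^ e

/-- What a node holds initially: a row of `A` and a row of `B`, along with their indices. -/
structure RowData (n : ℕ) where
  indexA : Fin n
  rowA : Fin n → ℤ
  indexB : Fin n
  rowB : Fin n → ℤ

/-- The local inputs if node `v` holds row `σA v` of `A` and row `σB v` of `B`. -/
def initialRows {V : Type} {n : ℕ} (A B : Matrix (Fin n) (Fin n) ℤ) (σA σB : V ≃ Fin n)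
    (v : V) : RowData n where
  indexA := σA v
  rowA := A (σA v)
  indexB := σB v
  rowB := B (σB v)

/-- Algorithms for matrix multiplication on `n` nodes with messages of at most `b ⌈log₂ n⌉` bits;
the output of a node is a row of the product. -/
abbrev MMAlgorithm (V : Type) (n b : ℕ) : Type 1 :=
  CongestAlgorithm V (RowData n) (Fin n → ℤ) (b * Nat.clog 2 n)

/-- On `G`, whenever `A` and `B` have at most `s` nonzero entries in each row and each column and
entries of size at most `n ^ e`, and however their rows are distributed, one of each per node,
with probability at least `p` the algorithm completes the task within `T` rounds: the node that
initially held row `i` of `B` holds row `i` of `A * B`. -/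
def MultipliesSparse {V : Type} {n b : ℕ} (alg : MMAlgorithm V n b) (G : SimpleGraph V)
    (s e T : ℕ) (p : ℝ) : Prop :=
  ∀ A B : Matrix (Fin n) (Fin n) ℤ, IsSparse A s → IsSparse B s →
    HasSmallEntries A e → HasSmallEntries B e → ∀ σA σB : V ≃ Fin n,
      p ≤ alg.successProb G (initialRows A B σA σB) (fun v => (A * B) (σB v)) T

end CorePeriphery

namespace CorePeriphery


/-! Upper bound. The main point is that in a core-periphery network every node can send and receive
`D` messages in `O(D + 1)` rounds (`exists_routing_time`). In the convergecast a core node `u`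
receives at most `γ * deg u` messages, and the balanced boundary gives `deg u = O(|C|)`; so each
core node represents `O(|C|)` nodes. Each representative spreads its clients evenly over `q ^ 2`
core nodes, the hosts, where `q = ⌊√|C|⌋`. Then each host serves `O(q ^ 2)` nodes (`exists_hosts`),
and any two hosts can exchange one message within `β` rounds. What remains is routing on a clique of
`q ^ 2` nodes with `O(D * q ^ 2)` tokens sent and received per node. It is solved deterministically
on a `q × q` grid by repeatedly dealing tokens evenly, first between groups and then inside groups
(`computes_route_clique`).

Given routing, multiplication uses outer products. The node in charge of index `j` collects column
`j` of `A` and row `j` of `B`. It forms at most `s ^ 2` nonzero products `A i j * B j l` and sends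
them to the node in charge of row `i`, which receives at most `s ^ 2` of them. Sums are then
forwarded to the nodes that want them (`exists_multiplication_time`). All loads are `O(s ^ 2 + 1)`.
No coins are used, so the success probability is 1.

Algorithms are composed as transitions between families of knowledge, indexed by the global input;
only at the end does `Learns.exists_algorithm` turn such a chain into a `CongestAlgorithm`.

Lower bound. In a clique on about `√n` nodes with pendant nodes attached, a pendant node sees only
one message per round. If it must output a product row made of `k ^ 2` free values in `{0, …, n}`,
none of which it knows, then counting transcripts (`card_le_of_half_le_successProb`) forces `T = Ω(k
^ 2)`. -/

/-! ## Families of local knowledge -/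

section Learns

variable {V A : Type} (G : SimpleGraph V) (w : ℕ)

open Classical in
/-- `κ a v` is what the node `v` knows if the global input is `a`. In one round of communication on
`G`, with messages of `w` bits, the nodes can pass from the knowledge `κ` to `κ'`. -/
def LearnsInOneRound {S S' : Type} (κ : A → V → S) (κ' : A → V → S') : Prop :=
  ∃ (send : V → S → V → Message w) (step : V → S → (V → Message w) → S'),
    ∀ a v, κ' a v = step v (κ a v) fun u => if G.Adj u v then send u (κ a u) v else none

/-- In `T` rounds the nodes can pass from the knowledge `κ` to the knowledge `κ'`. -/
def Learns {S' : Type} (κ' : A → V → S') : ℕ → ∀ {S : Type}, (A → V → S) → Prop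
  -- Local computation is free even with no rounds left, so zero-round statements serve as changes
  -- of representation.
  | 0, S, κ => ∃ f : V → S → S', ∀ a v, κ' a v = f v (κ a v)
  | T + 1, _, κ => ∃ (S₁ : Type) (κ₁ : A → V → S₁), LearnsInOneRound G w κ κ₁ ∧ Learns κ' T κ₁

variable {G w} {S S' S₀ S₁ S₂ R : Type}

theorem LearnsInOneRound.of_local {κ : A → V → S} {κ' : A → V → S'} {κ₀ : A → V → S₀}
    (h : LearnsInOneRound G w κ κ') (g : V → S₀ → S) (hg : ∀ a v, κ a v = g v (κ₀ a v)) :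
    LearnsInOneRound G w κ₀ κ' := by
  obtain ⟨send, step, h⟩ := h
  refine ⟨fun v s => send v (g v s), fun v s => step v (g v s), fun a v => ?_⟩
  simp only [h, hg]

theorem LearnsInOneRound.frame {κ : A → V → S} {κ' : A → V → S'}
    (h : LearnsInOneRound G w κ κ') (ρ : A → V → R) :
    LearnsInOneRound G w (fun a v => (ρ a v, κ a v)) (fun a v => (ρ a v, κ' a v)) := by
  obtain ⟨send, step, h⟩ := h
  refine ⟨fun v s => send v s.2, fun v s m => (s.1, step v s.2 m), fun a v => ?_⟩
  simp only [h]

theorem Learns.of_local {κ : A → V → S} {κ' : A → V → S'} {κ₀ : A → V → S₀} {T : ℕ}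
    (h : Learns G w κ' T κ) (g : V → S₀ → S) (hg : ∀ a v, κ a v = g v (κ₀ a v)) :
    Learns G w κ' T κ₀ := by
  cases T with
  | zero =>
    obtain ⟨f, hf⟩ := h
    exact ⟨fun v s => f v (g v s), fun a v => by rw [hf, hg]⟩
  | succ T =>
    obtain ⟨S₁, κ₁, h₁, h₂⟩ := h
    exact ⟨S₁, κ₁, h₁.of_local g hg, h₂⟩

theorem Learns.trans {κ₁ : A → V → S₁} {κ₂ : A → V → S₂} {T T' : ℕ}
    (h' : Learns G w κ₂ T' κ₁) {S : Type} {κ : A → V → S} (h : Learns G w κ₁ T κ) :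
    Learns G w κ₂ (T + T') κ := by
  induction T generalizing S with
  | zero =>
    obtain ⟨f, hf⟩ := h
    rw [Nat.zero_add]
    exact h'.of_local f hf
  | succ T ih =>
    obtain ⟨S₃, κ₃, h₃, h₄⟩ := h
    rw [Nat.succ_add]
    exact ⟨S₃, κ₃, h₃, ih h₄⟩

theorem Learns.frame {κ' : A → V → S'} {T : ℕ} (ρ : A → V → R) {S : Type} {κ : A → V → S}
    (h : Learns G w κ' T κ) :
    Learns G w (fun a v => (ρ a v, κ' a v)) T (fun a v => (ρ a v, κ a v)) := by
  induction T generalizing S with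
  | zero =>
    obtain ⟨f, hf⟩ := h
    exact ⟨fun v s => (s.1, f v s.2), fun a v => by simp only [hf]⟩
  | succ T ih =>
    obtain ⟨S₃, κ₃, h₃, h₄⟩ := h
    exact ⟨_, _, h₃.frame ρ, ih h₄⟩

theorem Learns.idle (κ : A → V → S) (T : ℕ) : Learns G w κ T κ := by
  induction T with
  | zero => exact ⟨fun _ s => s, fun _ _ => rfl⟩
  | succ T ih => exact ⟨S, κ, ⟨fun _ _ _ => none, fun _ s _ => s, fun _ _ => rfl⟩, ih⟩

theorem Learns.mono {κ : A → V → S} {κ' : A → V → S'} {T T' : ℕ} (h : Learns G w κ' T κ)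
    (hT : T ≤ T') : Learns G w κ' T' κ := by
  obtain ⟨d, rfl⟩ := Nat.exists_eq_add_of_le hT
  exact (Learns.idle κ' d).trans h

theorem Learns.chain (κ : ℕ → A → V → S) (T : ℕ)
    (h : ∀ t < T, LearnsInOneRound G w (κ t) (κ (t + 1))) : Learns G w (κ T) T (κ 0) := by
  induction T with
  | zero => exact ⟨fun _ s => s, fun _ _ => rfl⟩
  | succ T ih =>
    have h₁ : Learns G w (κ (T + 1)) 1 (κ T) :=
      ⟨_, _, h T (Nat.lt_succ_self T), ⟨fun _ s => s, fun _ _ => rfl⟩⟩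
    exact h₁.trans (ih fun t ht => h t (ht.trans (Nat.lt_succ_self T)))

/-- Knowledge that can be acquired in `T` rounds is computed by a deterministic algorithm. -/
theorem Learns.exists_algorithm {κ' : A → V → S'} {T : ℕ} {κ : A → V → S}
    (h : Learns G w κ' T κ) :
    ∃ alg : CongestAlgorithm V S S' w, ∀ a coin v,
      alg.output v (alg.run G (κ a) coin T v) = κ' a v := by
  induction T generalizing S with
  | zero =>
    obtain ⟨f, hf⟩ := h
    exact ⟨{ Coin := Unit, State := S, init := fun _ s _ => s, send := fun _ _ _ => none,
             step := fun _ s _ => s, output := f }, fun a coin v => (hf a v).symm⟩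
  | succ T ih =>
    obtain ⟨S₁, κ₁, ⟨send, step, h₁⟩, h₂⟩ := h
    obtain ⟨alg, halg⟩ := ih h₂
    have := alg.finiteCoin
    have := alg.nonemptyCoin
    let alg' : CongestAlgorithm V S S' w :=
      { Coin := alg.Coin
        State := (S × alg.Coin) ⊕ alg.State
        init := fun _ s c => .inl (s, c)
        send := fun v s u => match s with
          | .inl s => send v s.1 u
          | .inr s => alg.send v s u
        step := fun v s m => match s with
          | .inl s => .inr (alg.init v (step v s.1 m) s.2)
          | .inr s => .inr (alg.step v s m)
        output := fun v s => match s with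
          -- The value here is immaterial: after one round every state is an `inr`, and the output
          -- is only read after `T + 1` rounds.
          | .inl s => alg.output v (alg.init v (step v s.1 fun _ => none) s.2)
          | .inr s => alg.output v s }
    have key : ∀ a coin t v,
        alg'.run G (κ a) coin (t + 1) v = .inr (alg.run G (κ₁ a) coin t v) := by
      intro a coin t
      induction t with
      | zero =>
        intro v
        simp only [CongestAlgorithm.run, alg', h₁]
      | succ t iht =>
        intro v
        rw [CongestAlgorithm.run]
        simp only [iht]
        simp only [CongestAlgorithm.run, alg']
    refine ⟨alg', fun a coin v => ?_⟩
    rw [key]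
    exact halg a coin v

end Learns

/-! ## Data located at the nodes -/

section Located

variable {V A : Type} {J K I O M : Type}

open Classical in
/-- What the node `v` sees of the data `x` if the item `x j` is located at the node `s j`. -/
noncomputable def localView (s : J → V) (x : J → I) (v : V) (j : J) : Option I :=
  if s j = v then some (x j) else none

/-- The nodes, holding the data `x` at the locations `s`, can compute the data `y` at the
locations `t` in `T` rounds. -/
def Computes (G : SimpleGraph V) (w T : ℕ) (s : J → V) (x : A → J → I) (t : K → V)
    (y : A → K → O) : Prop :=
  Learns G w (fun a => localView t (y a)) T (fun a => localView s (x a))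

variable {G : SimpleGraph V} {w T T' : ℕ} {s : J → V} {x : A → J → I} {t : K → V}
  {y : A → K → O}

theorem Computes.trans (h : Computes G w T s x t y) {L N : Type} {r : L → V} {z : A → L → N}
    (h' : Computes G w T' t y r z) : Computes G w (T + T') s x r z :=
  Learns.trans h' h

theorem Computes.mono (h : Computes G w T s x t y) (hT : T ≤ T') : Computes G w T' s x t y :=
  Learns.mono h hT

theorem computes_of_local (f : K → (J → Option I) → O)
    (h : ∀ a k, y a k = f k (localView s (x a) (t k))) : Computes G w 0 s x t y := by
  classical
  refine ⟨fun v m k => if t k = v then some (f k m) else none, fun a v => ?_⟩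
  funext k
  by_cases hk : t k = v
  · subst hk
    simp [localView, h]
  · simp [localView, hk]

theorem computes_map {y : A → J → O} (f : J → I → O) (h : ∀ a j, y a j = f j (x a j)) :
    Computes G w 0 s x s y := by
  classical
  refine ⟨fun v m j => (m j).map (f j), fun a v => ?_⟩
  funext j
  by_cases hj : s j = v <;> simp [localView, hj, h]

theorem Computes.frame {y : A → J → O} (h : Computes G w T s x s y) :
    Computes G w T s x s (fun a j => (x a j, y a j)) := by
  classical
  have h₁ := (Learns.frame (fun a => localView s (x a)) h).of_local (κ₀ := fun a => localView s (x a))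
    (fun _ m => (m, m)) fun _ _ => rfl
  have h₂ : Learns G w (fun a => localView s (fun j => (x a j, y a j))) 0
      (fun a v => (localView s (x a) v, localView s (y a) v)) := by
    refine ⟨fun v m j => (m.1 j).bind fun i => (m.2 j).map fun o => (i, o), fun a v => ?_⟩
    funext j
    by_cases hj : s j = v <;> simp [localView, hj]
  exact h₂.trans h₁

/-- Messages that can be delivered on a fixed schedule carry data to their destinations. -/
theorem CanDeliver.computes {src dst : J → V} (h : CanDeliver G src (fun j => {dst j}) T)
    (code : M ↪ (Fin w → Bool)) (x : A → J → Option M) : Computes G w T src x dst x := by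
  classical
  obtain ⟨pos, h0, hT, hstep, hinj⟩ := h
  have e0 : src = fun j => pos j 0 := funext fun j => (h0 j).symm
  have eT : dst = fun j => pos j T := funext fun j => (hT j).symm
  rw [e0, eT]
  refine Learns.chain (fun t a => localView (fun j => pos j t) (x a)) T fun t ht => ?_
  -- The schedule is fixed, so sender and receiver both know which item crosses the edge from `u` to
  -- `v` in round `t`; edge capacity makes this `j` unique. An item equal to `none` is conveyed by
  -- silence.
  refine ⟨fun u m v => if h : ∃ j, pos j t = u ∧ pos j (t + 1) = v ∧ u ≠ v then
      ((m h.choose).join).map code else none,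
    fun v m r j => if pos j (t + 1) = v then (if pos j t = v then m j else
      some ((r (pos j t)).bind (Function.partialInv code))) else none, fun a v => ?_⟩
  funext j
  by_cases h1 : pos j (t + 1) = v
  · subst h1
    by_cases h2 : pos j t = pos j (t + 1)
    · simp [localView, h2]
    · have hadj : G.Adj (pos j t) (pos j (t + 1)) :=
        (hstep j t ht).resolve_left fun h => h2 h.symm
      have hex : ∃ i, pos i t = pos j t ∧ pos i (t + 1) = pos j (t + 1) ∧
          pos j t ≠ pos j (t + 1) := ⟨j, rfl, rfl, h2⟩
      have hc : hex.choose = j := by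
        obtain ⟨c1, c2, c3⟩ := hex.choose_spec
        refine hinj _ _ t ht c1 c2 ?_
        rw [c1, c2]
        exact fun h => c3 h.symm
      simp only [if_true, if_neg h2, if_pos hadj, dif_pos hex, hc, localView]
      cases x a j with
      | none => simp
      | some z => simp [Function.partialInv_left code.injective]
  · simp [localView, h1]

end Located


/-! ## Combining delivery schedules -/

section Schedules

variable {V ι κ : Type} {G : SimpleGraph V} {src dst mid : ι → V} {T T' : ℕ}

theorem CanDeliver.trans (h : CanDeliver G src (fun i => {mid i}) T)
    (h' : CanDeliver G mid (fun i => {dst i}) T') :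
    CanDeliver G src (fun i => {dst i}) (T + T') := by
  obtain ⟨p, p0, pT, ps, pi⟩ := h
  obtain ⟨p', p0', pT', ps', pi'⟩ := h'
  have hm : ∀ i, p i T = p' i 0 := fun i => by rw [p0' i]; exact pT i
  let r : ι → ℕ → V := fun i t => if t ≤ T then p i t else p' i (t - T)
  have r1 : ∀ i t, t ≤ T → r i t = p i t := fun i t ht => if_pos ht
  have r2 : ∀ i t, r i (T + t) = p' i t := by
    intro i t
    rcases Nat.eq_zero_or_pos t with rfl | ht
    · rw [Nat.add_zero, r1 i T le_rfl, hm]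
    · simp only [r]
      rw [if_neg (by omega), Nat.add_sub_cancel_left]
  refine ⟨r, fun i => by rw [r1 i 0 (Nat.zero_le _), p0], fun i => by rw [r2]; exact pT' i, ?_, ?_⟩
  · intro i t ht
    rcases lt_or_ge t T with h | h
    · rw [r1 i t h.le, r1 i (t + 1) h]
      exact ps i t h
    · obtain ⟨d, rfl⟩ := Nat.exists_eq_add_of_le h
      rw [Nat.add_assoc, r2, r2]
      exact ps' i d (by omega)
  · intro i j t ht
    rcases lt_or_ge t T with h | h
    · rw [r1 i t h.le, r1 i (t + 1) h, r1 j t h.le, r1 j (t + 1) h]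
      exact pi i j t h
    · obtain ⟨d, rfl⟩ := Nat.exists_eq_add_of_le h
      rw [Nat.add_assoc, r2, r2, r2, r2]
      exact pi' i j d (by omega)

/-- Running a schedule backwards turns each crossing of an edge into one in the opposite direction
at the mirrored time, so capacities are still respected. This brings tokens from hosts back to their
clients. -/
theorem CanDeliver.reverse (h : CanDeliver G src (fun i => {dst i}) T) :
    CanDeliver G dst (fun i => {src i}) T := by
  obtain ⟨p, p0, pT, ps, pi⟩ := h
  refine ⟨fun i t => p i (T - t), fun i => pT i, fun i => ?_, fun i t ht => ?_,
    fun i j t ht h1 h2 h3 => ?_⟩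
  · simp [p0]
  · have e : T - t = T - (t + 1) + 1 := by omega
    beta_reduce
    rw [e]
    rcases ps i (T - (t + 1)) (by omega) with h | h
    · exact .inl h.symm
    · exact .inr h.symm
  · have e : T - t = T - (t + 1) + 1 := by omega
    beta_reduce at h1 h2 h3
    rw [e] at h1 h3
    exact pi i j (T - (t + 1)) (by omega) h2 h1 h3.symm

theorem CanDeliver.comp_injective {dest : ι → Set V} (h : CanDeliver G src dest T) (f : κ → ι)
    (hf : Function.Injective f) : CanDeliver G (src ∘ f) (dest ∘ f) T := by
  obtain ⟨p, p0, pT, ps, pi⟩ := h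
  exact ⟨fun i => p (f i), fun i => p0 _, fun i => pT _, fun i => ps _,
    fun i j t ht h1 h2 h3 => hf (pi _ _ t ht h1 h2 h3)⟩

/-- Up to `L` messages along each route of a schedule for time `T` take time `L * T`. -/
theorem CanDeliver.repeat (h : CanDeliver G src (fun i => {dst i}) T) (f : κ → ι) {L : ℕ}
    (slot : κ → Fin L) (hf : ∀ i j, f i = f j → slot i = slot j → i = j) :
    CanDeliver G (fun i => src (f i)) (fun i => {dst (f i)}) (L * T) := by
  obtain ⟨p, p0, pT, ps, pi⟩ := h
  have move : ∀ i t, p (f i) (min (t + 1 - slot i * T) T) ≠ p (f i) (min (t - slot i * T) T) →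
      slot i * T ≤ t ∧ t < (slot i + 1) * T := by
    intro i t hne
    rw [Nat.add_mul, Nat.one_mul]
    by_contra hcon
    apply hne
    congr 1
    omega
  -- Message `i` waits for `slot i * T` rounds, follows its route for `T` rounds and then rests;
  -- truncated subtraction and `min` encode the two rests. Messages moving in the same round have
  -- the same slot, so they never share a route.
  refine ⟨fun i t => p (f i) (min (t - slot i * T) T), fun i => by simp [p0], fun i => ?_,
    fun i t ht => ?_, fun i j t ht h1 h2 h3 => ?_⟩
  · have : (slot i + 1) * T ≤ L * T := Nat.mul_le_mul_right _ (slot i).2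
    rw [Nat.add_mul, Nat.one_mul] at this
    beta_reduce
    rw [min_eq_right (by omega)]
    exact pT _
  · beta_reduce
    by_cases hne : p (f i) (min (t + 1 - slot i * T) T) = p (f i) (min (t - slot i * T) T)
    · exact .inl hne
    · obtain ⟨b1, b2⟩ := move i t hne
      rw [Nat.add_mul, Nat.one_mul] at b2
      rw [min_eq_left (by omega), min_eq_left (by omega),
        show t + 1 - slot i * T = t - slot i * T + 1 by omega]
      exact ps _ _ (by omega)
  · beta_reduce at h1 h2 h3
    have h3' : p (f j) (min (t + 1 - slot j * T) T) ≠ p (f j) (min (t - slot j * T) T) := by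
      rw [← h1, ← h2]; exact h3
    obtain ⟨b1, b2⟩ := move i t h3
    obtain ⟨c1, c2⟩ := move j t h3'
    have hs : slot i = slot j := by
      have hT : 0 < T := by
        rw [Nat.add_mul, Nat.one_mul] at b2
        omega
      have u1 : (slot i : ℕ) < slot j + 1 := lt_of_mul_lt_mul_right (b1.trans_lt c2) hT.le
      have u2 : (slot j : ℕ) < slot i + 1 := lt_of_mul_lt_mul_right (c1.trans_lt b2) hT.le
      exact Fin.ext (by omega)
    refine hf i j ?_ hs
    rw [← hs] at h1 h2
    rw [Nat.add_mul, Nat.one_mul] at b2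
    simp only [min_eq_left (show t - slot i * T ≤ T by omega),
      min_eq_left (show t - slot i * T + 1 ≤ T by omega),
      show t + 1 - slot i * T = t - slot i * T + 1 by omega] at h1 h2 h3
    exact pi _ _ _ (by omega) h1 h2 h3

/-- A version of `CanDeliver.repeat` where the number of messages for each route is bounded. -/
theorem CanDeliver.of_card_le [Fintype κ] [DecidableEq ι] (h : CanDeliver G src (fun i => {dst i}) T) (f : κ → ι)
    {L : ℕ} (hL : ∀ i, (Finset.univ.filter fun k => f k = i).card ≤ L) :
    CanDeliver G (fun k => src (f k)) (fun k => {dst (f k)}) (L * T) := by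
  let F : ι → Finset κ := fun i => Finset.univ.filter fun k => f k = i
  have hmem : ∀ k, k ∈ F (f k) := fun k => by simp [F]
  refine h.repeat f
    (fun k => ⟨(F (f k)).equivFin ⟨k, hmem k⟩, lt_of_lt_of_le (Fin.is_lt _) (hL (f k))⟩) ?_
  intro i j hij hs
  have hs' := congrArg Fin.val hs
  have key : ∀ (m : ι) (_ : f j = m) (hj : j ∈ F m),
      (((F m).equivFin ⟨j, hj⟩ : Fin _) : ℕ) = ((F (f j)).equivFin ⟨j, hmem j⟩ : Fin _) := by
    rintro m rfl hj
    rfl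
  have hj : j ∈ F (f i) := by simp [F, hij]
  have e := hs'.trans (key (f i) hij.symm hj).symm
  have := (F (f i)).equivFin.injective (Fin.ext e)
  exact congrArg Subtype.val this

end Schedules

/-! ## Shipping sets of tokens -/

section Ship

variable {V A ι J K S E : Type} {G : SimpleGraph V} {w T : ℕ} {s : J → V} {t : K → V}

/-- If at most one message along each route `i`, from `fr i` to `tgt i`, can be delivered in time
`T`, then sets of `L` tokens along each of these routes can be delivered in time `L * T`. -/
theorem CanDeliver.computes_ship [Fintype ι] [DecidableEq E] [DecidableEq K] {fr : ι → J} {tgt : ι → K}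
    (h : CanDeliver G (fun i => s (fr i)) (fun i => {t (tgt i)}) T) (code : E ↪ (Fin w → Bool))
    (x : A → J → S) (Y : A → ι → Finset E) (f : ι → S → Finset E)
    (hY : ∀ a i, Y a i = f i (x a (fr i))) (L : ℕ) (hL : ∀ a i, (Y a i).card ≤ L) :
    Computes G w (L * T) s x t
      (fun a k => (Finset.univ.filter fun i => tgt i = k).biUnion (Y a)) := by
  -- The `l`-th message along route `i` is the `l`-th token in a list of `Y a i`, or `none` if there
  -- are fewer tokens.
  let z : A → ι × Fin L → Option E := fun a i => (Y a i.1).toList[(i.2 : ℕ)]?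
  have h1 : Computes G w 0 s x (fun i : ι × Fin L => s (fr i.1)) z := by
    refine computes_of_local
      (fun i m => (m (fr i.1)).bind fun y => (f i.1 y).toList[(i.2 : ℕ)]?) fun a i => ?_
    simp [localView, z, hY]
  have h2 := (h.repeat (fun i : ι × Fin L => i.1) (fun i => i.2)
    (fun i j => Prod.ext)).computes code z
  have h3 : Computes G w 0 (fun i : ι × Fin L => t (tgt i.1)) z t
      (fun a k => (Finset.univ.filter fun i => tgt i = k).biUnion (Y a)) := by
    refine computes_of_local (fun k m => (Finset.univ.filter fun i => tgt i = k).biUnion fun i =>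
      Finset.univ.biUnion fun l : Fin L => ((m (i, l)).join).toFinset) fun a k => ?_
    refine Finset.biUnion_congr rfl fun i hi => ?_
    have hi' : tgt i = k := (Finset.mem_filter.1 hi).2
    ext e
    simp only [localView, hi', if_true, Finset.mem_biUnion, Finset.mem_univ, true_and,
      Option.mem_toFinset, Option.join_some, Option.mem_def, z]
    rw [← Finset.mem_toList, List.mem_iff_getElem?]
    constructor
    · rintro ⟨l, hl⟩
      have hlt : l < (Y a i).toList.length := (List.getElem?_eq_some_iff.1 hl).1
      rw [Finset.length_toList] at hlt
      exact ⟨⟨l, hlt.trans_le (hL a i)⟩, hl⟩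
    · rintro ⟨l, hl⟩
      exact ⟨l, hl⟩
  have := (h1.trans h2).trans h3
  simpa using this

end Ship


/-! ## Dealing tokens evenly -/

section Deal

variable {E β : Type} [DecidableEq β]

/-- Number the elements of `S` and reduce modulo `q`: each residue class has at most `S.card / q +
1` members. Multiplying by `q` keeps the bound free of division. -/
theorem exists_even_assignment (q : ℕ) [NeZero q] (S : Finset E) :
    ∃ r : E → Fin q, ∀ x, q * (S.filter fun e => r e = x).card ≤ S.card + q := by
  classical
  have hq : 0 < q := Nat.pos_of_ne_zero (NeZero.ne q)
  let num : E → ℕ := fun e => if h : e ∈ S then S.equivFin ⟨e, h⟩ else 0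
  have hnum : ∀ e ∈ S, num e < S.card := fun e he => by simp [num, he]
  have hinj : ∀ e ∈ S, ∀ e' ∈ S, num e = num e' → e = e' := by
    intro e he e' he' h
    simp only [num, he, he', dif_pos] at h
    exact congrArg Subtype.val (S.equivFin.injective (Fin.ext h))
  refine ⟨fun e => ⟨num e % q, Nat.mod_lt _ hq⟩, fun x => ?_⟩
  have hcard : (S.filter fun e => (⟨num e % q, Nat.mod_lt _ hq⟩ : Fin q) = x).card ≤
      (Finset.range (S.card / q + 1)).card := by
    refine Finset.card_le_card_of_injOn (fun e => num e / q) ?_ ?_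
    · intro e he
      have he' := (Finset.mem_filter.1 he).1
      have := Nat.div_le_div_right (c := q) (hnum e he').le
      simp only [Finset.coe_range, Set.mem_Iio]
      omega
    · intro e he e' he' h
      have he := Finset.mem_filter.1 he
      have he' := Finset.mem_filter.1 he'
      refine hinj e he.1 e' he'.1 ?_
      have hm : num e % q = num e' % q := by
        have := he.2.trans he'.2.symm
        simpa using this
      rw [← Nat.div_add_mod (num e) q, ← Nat.div_add_mod (num e') q, hm]
      simp only at h
      rw [h]
  rw [Finset.card_range] at hcard
  calc _ ≤ q * (S.card / q + 1) := Nat.mul_le_mul_left _ hcard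
    _ ≤ _ := by
      rw [Nat.mul_add, Nat.mul_one]
      exact Nat.add_le_add_right (Nat.mul_div_le _ _) _

theorem exists_even_assignment_of_label (q : ℕ) [NeZero q] (S : Finset E) (lab : E → β) :
    ∃ r : E → Fin q, ∀ b x, q * (S.filter fun e => lab e = b ∧ r e = x).card ≤
      (S.filter fun e => lab e = b).card + q := by
  choose r hr using fun b => exists_even_assignment q (S.filter fun e => lab e = b)
  refine ⟨fun e => r (lab e) e, fun b x => ?_⟩
  refine le_trans (Nat.mul_le_mul_left _ (Finset.card_le_card ?_)) (hr b x)
  intro e he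
  simp only [Finset.mem_filter] at he ⊢
  obtain ⟨h1, rfl, h2⟩ := he
  exact ⟨⟨h1, rfl⟩, h2⟩

/-- Distribute the elements of `S` with any given label evenly over `q` places. -/
noncomputable def deal (q : ℕ) [NeZero q] (S : Finset E) (lab : E → β) : E → Fin q :=
  (exists_even_assignment_of_label q S lab).choose

theorem deal_spec (q : ℕ) [NeZero q] (S : Finset E) (lab : E → β) (b : β) (x : Fin q) :
    q * (S.filter fun e => lab e = b ∧ deal q S lab e = x).card ≤
      (S.filter fun e => lab e = b).card + q :=
  (exists_even_assignment_of_label q S lab).choose_spec b x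

theorem sum_card_filter_and [Fintype β] (S : Finset E) (Q : E → Prop) [DecidablePred Q] (g : E → β) :
    ∑ b, (S.filter fun e => g e = b ∧ Q e).card = (S.filter Q).card := by
  rw [Finset.card_eq_sum_card_fiberwise (f := g) (t := Finset.univ) fun _ _ => Finset.mem_univ _]
  refine Finset.sum_congr rfl fun b _ => ?_
  rw [Finset.filter_filter]
  congr 1
  ext e
  simp only [Finset.mem_filter]
  tauto

theorem sum_card_filter_eq [Fintype β] (S : Finset E) (g : E → β) :
    ∑ b, (S.filter fun e => g e = b).card = S.card :=
  (Finset.card_eq_sum_card_fiberwise (f := g) (t := Finset.univ) fun _ _ => Finset.mem_univ _).symm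

/-- Rounding costs at most `q` for each of the `q` labels, whence the error term `q ^ 2`. -/
theorem deal_total (q : ℕ) [NeZero q] (S : Finset E) (lab : E → Fin q) (x : Fin q) :
    q * (S.filter fun e => deal q S lab e = x).card ≤ S.card + q ^ 2 := by
  rw [← sum_card_filter_and S (fun e => deal q S lab e = x) lab, Finset.mul_sum]
  calc _ ≤ ∑ b, ((S.filter fun e => lab e = b).card + q) :=
        Finset.sum_le_sum fun b _ => deal_spec q S lab b x
    _ = _ := by
      rw [Finset.sum_add_distrib, sum_card_filter_eq]
      simp [sq]

end Deal

/-! ## Routing on a clique -/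

section Clique

variable {V A P E S : Type} [Fintype P] [DecidableEq P] [DecidableEq E] {G : SimpleGraph V} {w T : ℕ} {host : P → V}

/-- The tokens held after each `p` has sent each of its tokens `e ∈ X p` to `d p (X p) e`. -/
noncomputable def shuffle (d : P → Finset E → E → P) (X : P → Finset E) (p' : P) : Finset E :=
  Finset.univ.biUnion fun p => (X p).filter fun e => d p (X p) e = p'

theorem mem_shuffle {d : P → Finset E → E → P} {X : P → Finset E} {p' : P} {e : E} :
    e ∈ shuffle d X p' ↔ ∃ p, e ∈ X p ∧ d p (X p) e = p' := by
  simp [shuffle]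

theorem exists_mem_shuffle {d : P → Finset E → E → P} {X : P → Finset E} {e : E} :
    (∃ p, e ∈ shuffle d X p) ↔ ∃ p, e ∈ X p := by
  simp [mem_shuffle]

theorem card_filter_shuffle_le (d : P → Finset E → E → P) (X : P → Finset E) (p' : P)
    (Q : E → Prop) [DecidablePred Q] : ((shuffle d X p').filter Q).card ≤
      ∑ p, ((X p).filter fun e => d p (X p) e = p' ∧ Q e).card := by
  rw [shuffle, Finset.filter_biUnion]
  refine Finset.card_biUnion_le.trans (Finset.sum_le_sum fun p _ => ?_)
  rw [Finset.filter_filter]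

theorem card_shuffle_le (d : P → Finset E → E → P) (X : P → Finset E) (p' : P) :
    (shuffle d X p').card ≤ ∑ p, ((X p).filter fun e => d p (X p) e = p').card :=
  Finset.card_biUnion_le

theorem sum_card_filter_shuffle_le (d : P → Finset E → E → P) (X : P → Finset E)
    (Q : E → Prop) [DecidablePred Q] : ∑ p, ((shuffle d X p).filter Q).card ≤ ∑ p, ((X p).filter Q).card := by
  refine (Finset.sum_le_sum fun p _ => card_filter_shuffle_le d X p Q).trans ?_
  rw [Finset.sum_comm]
  exact Finset.sum_le_sum fun p _ => (sum_card_filter_and (X p) Q _).le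

theorem computes_hop (h : CanDeliver G (fun i : P × P => host i.1) (fun i => {host i.2}) T)
    (code : E ↪ (Fin w → Bool)) (x : A → P → S) (Y : A → P → P → Finset E)
    (f : P → P → S → Finset E) (hY : ∀ a p p', Y a p p' = f p p' (x a p)) (L : ℕ)
    (hL : ∀ a p p', (Y a p p').card ≤ L) :
    Computes G w (L * T) host x host (fun a p' => Finset.univ.biUnion fun p => Y a p p') := by
  have := h.computes_ship (s := host) (t := host) code x (fun a i => Y a i.1 i.2)
    (fun i => f i.1 i.2) (fun a i => hY a i.1 i.2) L (fun a i => hL a i.1 i.2)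
  convert this using 3 with a p'
  ext e
  simp

/-- Tokens can be sent directly if each node has at most `L` of them for each other node. -/
theorem computes_shuffle (h : CanDeliver G (fun i : P × P => host i.1) (fun i => {host i.2}) T)
    (code : E ↪ (Fin w → Bool)) (d : P → Finset E → E → P) (X : A → P → Finset E) (L : ℕ)
    (hL : ∀ a p p', ((X a p).filter fun e => d p (X a p) e = p').card ≤ L) :
    Computes G w (L * T) host X host (fun a => shuffle d (X a)) :=
  computes_hop h code X (fun a p p' => (X a p).filter fun e => d p (X a p) e = p')
    (fun p p' S => S.filter fun e => d p S e = p') (fun _ _ _ => rfl) L hL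

/-- Tokens can be sent to their targets `d` by way of the relays `r`. -/
theorem computes_shuffle_relayed
    (h : CanDeliver G (fun i : P × P => host i.1) (fun i => {host i.2}) T)
    (code : E × P ↪ (Fin w → Bool)) (r d : P → Finset E → E → P) (X : A → P → Finset E)
    (L₁ L₂ : ℕ) (h₁ : ∀ a p p', ((X a p).filter fun e => r p (X a p) e = p').card ≤ L₁)
    (h₂ : ∀ a p' p'', ∑ p, ((X a p).filter fun e =>
      r p (X a p) e = p' ∧ d p (X a p) e = p'').card ≤ L₂) :
    Computes G w ((L₁ + L₂) * T) host X host (fun a => shuffle d (X a)) := by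
  -- Each token travels with its target attached, since the target depends on the origin's whole
  -- token set, which the relay does not know.
  have c₁ := computes_hop h code X
    (fun a p p' => ((X a p).filter fun e => r p (X a p) e = p').image
      fun e => (e, d p (X a p) e))
    (fun p p' S => (S.filter fun e => r p S e = p').image fun e => (e, d p S e))
    (fun _ _ _ => rfl) L₁ (fun a p p' => Finset.card_image_le.trans (h₁ a p p'))
  have c₂ := c₁.trans (computes_shuffle h code (fun _ _ e => e.2) _ L₂ fun a p' p'' => by
    refine le_trans ?_ (h₂ a p' p'')
    rw [Finset.filter_biUnion]
    refine Finset.card_biUnion_le.trans (Finset.sum_le_sum fun p _ => ?_)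
    rw [Finset.filter_image, Finset.filter_filter]
    exact Finset.card_image_le)
  have c₃ := c₂.trans (computes_map (y := fun a => shuffle d (X a)) (fun _ S => S.image Prod.fst)
    fun a p'' => by
      ext e
      simp only [mem_shuffle, Finset.mem_image, Finset.mem_biUnion, Finset.mem_univ, true_and,
        Finset.mem_filter]
      constructor
      · rintro ⟨p, he, rfl⟩
        exact ⟨_, ⟨_, ⟨p, e, ⟨he, rfl⟩, rfl⟩, rfl⟩, rfl⟩
      · rintro ⟨_, ⟨_, ⟨p, e, ⟨he, rfl⟩, rfl⟩, rfl⟩, rfl⟩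
        exact ⟨p, he, rfl⟩)
  refine c₃.mono ?_
  rw [Nat.add_mul, Nat.add_zero]

end Clique

/-! ### Delivery inside the groups of a `q × q` grid. -/

section Grid

variable {V A E : Type} [DecidableEq E] {q : ℕ} [NeZero q] {G : SimpleGraph V} {w T : ℕ} {host : Fin q × Fin q → V}

theorem le_of_mul_le_mul_add {q m L : ℕ} [NeZero q] (h : q * m ≤ L * q + q) : m ≤ L + 1 := by
  refine Nat.le_of_mul_le_mul_left (c := q) ?_ (Nat.pos_of_ne_zero (NeZero.ne q))
  linarith

/-- Delivery within the groups `{x} × Fin q`, if each node has at most `L * q` tokens for each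
member of its group. -/
theorem computes_shuffle_in_group
    (h : CanDeliver G (fun i : (Fin q × Fin q) × (Fin q × Fin q) => host i.1)
      (fun i => {host i.2}) T)
    (code : E × (Fin q × Fin q) ↪ (Fin w → Bool)) (d : Fin q × Fin q → Finset E → E → Fin q)
    (X : A → Fin q × Fin q → Finset E) (L : ℕ)
    (hL : ∀ a p b, ((X a p).filter fun e => d p (X a p) e = b).card ≤ L * q) :
    Computes G w ((2 * L + 2) * T) host X host
      (fun a => shuffle (fun p S e => (p.1, d p S e)) (X a)) := by
  have key : ∀ a p b y,
      ((X a p).filter fun e => d p (X a p) e = b ∧ deal q (X a p) (d p (X a p)) e = y).card ≤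
        L + 1 := fun a p b y =>
    le_of_mul_le_mul_add (q := q) ((deal_spec q (X a p) (d p (X a p)) b y).trans
      (Nat.add_le_add_right (hL a p b) q))
  -- A Latin square chooses the relays: a token from `(x, c')` to `(x, b)` passes through `(y, c' +
  -- b)`, where `y` is dealt evenly. The relay `(y, c)` thus gets tokens for `(x, b)` from `(x, c -
  -- b)` only, so both hops have load at most `L + 1`.
  have := computes_shuffle_relayed h code
    (fun p S e => (deal q S (d p S) e, p.2 + d p S e)) (fun p S e => (p.1, d p S e)) X
    (L + 1) (L + 1) ?_ ?_
  · exact this.mono (Nat.mul_le_mul_right _ (by omega))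
  · rintro a p ⟨y, c⟩
    refine (Finset.card_le_card ?_).trans (key a p (c - p.2) y)
    intro e he
    simp only [Finset.mem_filter, Prod.mk.injEq] at he ⊢
    exact ⟨he.1, eq_sub_of_add_eq' he.2.2, he.2.1⟩
  · rintro a ⟨y, c⟩ ⟨x, b⟩
    rw [Finset.sum_eq_single (x, c - b)]
    · refine (Finset.card_le_card ?_).trans (key a (x, c - b) b y)
      intro e he
      simp only [Finset.mem_filter, Prod.mk.injEq] at he ⊢
      exact ⟨he.1, he.2.2.2, he.2.1.1⟩
    · rintro p - hp
      rw [Finset.card_eq_zero, Finset.filter_eq_empty_iff]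
      rintro e - he
      simp only [Prod.mk.injEq] at he
      obtain ⟨⟨h1, h2⟩, h3, h4⟩ := he
      apply hp
      ext1
      · exact h3
      · rw [h4] at h2
        exact eq_sub_of_add_eq h2
    · intro hn
      exact absurd (Finset.mem_univ _) hn

end Grid


/-! ### Balanced routing on a clique of `q ^ 2` nodes. -/

section Route

variable {V A E : Type} {q : ℕ} [NeZero q] {G : SimpleGraph V} {w T : ℕ}
  {host : Fin q × Fin q → V}

theorem le_of_mul_le_sq_mul {q m L : ℕ} [NeZero q] (h : q * m ≤ L * q ^ 2) : m ≤ L * q := by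
  refine Nat.le_of_mul_le_mul_left (c := q) ?_ (Nat.pos_of_ne_zero (NeZero.ne q))
  linarith [show q * (L * q) = L * q ^ 2 by ring]

/-- Distribute the tokens with each label evenly over the groups, and the tokens for each group
evenly over its members. -/
noncomputable def dealTwice (q : ℕ) [NeZero q] (S : Finset E) (lab : E → Fin q) (e : E) :
    Fin q × Fin q :=
  (deal q S lab e, deal q S (deal q S lab) e)

/-- Dealing by `lab` leaves at most `(D + 1) * q` tokens for each group; dealing these over the `q`
members leaves at most `D + 2` for each node. -/
theorem dealTwice_card_le {S : Finset E} {lab : E → Fin q} {D : ℕ} (hS : S.card ≤ D * q ^ 2)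
    (r : Fin q × Fin q) : (S.filter fun e => dealTwice q S lab e = r).card ≤ D + 2 := by
  have h₁ : (S.filter fun e => deal q S lab e = r.1).card ≤ (D + 1) * q :=
    le_of_mul_le_sq_mul (by linarith [deal_total q S lab r.1])
  refine le_of_mul_le_mul_add (q := q) (le_trans ?_ (Nat.add_le_add_right h₁ q))
  simpa only [dealTwice, Prod.ext_iff] using deal_spec q S (deal q S lab) r.1 r.2

theorem deal_card_le {S : Finset E} {lab : E → Fin q} {D : ℕ} (hS : S.card ≤ D * q ^ 2)
    (b : Fin q) : (S.filter fun e => deal q S lab e = b).card ≤ (D + 1) * q :=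
  le_of_mul_le_sq_mul (by linarith [deal_total q S lab b])

variable [DecidableEq E]

/-- Dealing label by label also balances each label over the groups: group `x` gets a `1 / q` share
of the tokens labelled `g`, with a rounding error of at most 1 for each of the `q ^ 2` senders. -/
theorem sum_dealTwice_card_le {X : Fin q × Fin q → Finset E} {lab : E → Fin q} {D : ℕ}
    (hX : ∀ g, ∑ p, ((X p).filter fun e => lab e = g).card ≤ D * q ^ 3) (x g : Fin q) :
    ∑ b, ((shuffle (fun _ S e => dealTwice q S lab e) X (x, b)).filter
      fun e => lab e = g).card ≤ (D + 1) * q ^ 2 := by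
  have h₁ : ∑ b, ((shuffle (fun _ S e => dealTwice q S lab e) X (x, b)).filter
      fun e => lab e = g).card ≤
      ∑ p, ((X p).filter fun e => lab e = g ∧ deal q (X p) lab e = x).card := by
    refine (Finset.sum_le_sum fun b _ => card_filter_shuffle_le _ X (x, b) _).trans ?_
    rw [Finset.sum_comm]
    refine Finset.sum_le_sum fun p _ => ?_
    rw [← sum_card_filter_and (X p) _ (deal q (X p) (deal q (X p) lab))]
    refine Finset.sum_le_sum fun b _ => Finset.card_le_card fun e he => ?_
    simp only [Finset.mem_filter, dealTwice, Prod.mk.injEq] at he ⊢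
    tauto
  refine h₁.trans ?_
  refine Nat.le_of_mul_le_mul_left (c := q) ?_ (Nat.pos_of_ne_zero (NeZero.ne q))
  rw [Finset.mul_sum]
  calc _ ≤ ∑ p, (((X p).filter fun e => lab e = g).card + q) :=
        Finset.sum_le_sum fun p _ => deal_spec q (X p) lab g x
    _ ≤ D * q ^ 3 + q ^ 3 := by
        rw [Finset.sum_add_distrib]
        refine Nat.add_le_add (hX g) (le_of_eq ?_)
        simp
        ring
    _ = q * ((D + 1) * q ^ 2) := by ring

/-- The same balancing inside group `x`, where only its `q` members send to one another. -/
theorem sum_deal_card_le {X : Fin q × Fin q → Finset E} {lab : E → Fin q} {D : ℕ} {x g : Fin q}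
    (hX : ∑ b, ((X (x, b)).filter fun e => lab e = g).card ≤ D * q ^ 2) (b' : Fin q) :
    ((shuffle (fun p S e => (p.1, deal q S lab e)) X (x, b')).filter
      fun e => lab e = g).card ≤ (D + 1) * q := by
  have h₁ : ((shuffle (fun p S e => (p.1, deal q S lab e)) X (x, b')).filter
      fun e => lab e = g).card ≤
      ∑ b, ((X (x, b)).filter fun e => lab e = g ∧ deal q (X (x, b)) lab e = b').card := by
    refine (card_filter_shuffle_le _ X (x, b') _).trans ?_
    rw [Fintype.sum_prod_type, Finset.sum_eq_single x]
    · refine Finset.sum_le_sum fun b _ => Finset.card_le_card fun e he => ?_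
      simp only [Finset.mem_filter, Prod.mk.injEq] at he ⊢
      tauto
    · intro x' _ hx'
      refine Finset.sum_eq_zero fun b _ => ?_
      rw [Finset.card_eq_zero, Finset.filter_eq_empty_iff]
      rintro e - he
      exact hx' (congrArg Prod.fst he.1)
    · intro hn
      exact absurd (Finset.mem_univ _) hn
  refine le_of_mul_le_sq_mul ((Nat.mul_le_mul_left q h₁).trans ?_)
  rw [Finset.mul_sum]
  calc _ ≤ ∑ b, (((X (x, b)).filter fun e => lab e = g).card + q) :=
        Finset.sum_le_sum fun b _ => deal_spec q (X (x, b)) lab g b'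
    _ ≤ D * q ^ 2 + q ^ 2 := by
        rw [Finset.sum_add_distrib]
        refine Nat.add_le_add hX (le_of_eq ?_)
        simp [sq]
    _ = (D + 1) * q ^ 2 := by ring

/-- On a clique with `q ^ 2` nodes, where each node sends and receives at most `D * q ^ 2` tokens,
all tokens can be delivered within `O(D)` rounds of all-to-all communication. -/
theorem computes_route_clique
    (h : CanDeliver G (fun i : (Fin q × Fin q) × (Fin q × Fin q) => host i.1)
      (fun i => {host i.2}) T)
    (code : E × (Fin q × Fin q) ↪ (Fin w → Bool)) (dest : E → Fin q × Fin q)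
    (X : A → Fin q × Fin q → Finset E) (D : ℕ) (hsend : ∀ a p, (X a p).card ≤ D * q ^ 2)
    (hrec : ∀ a r, ∑ p, ((X a p).filter fun e => dest e = r).card ≤ D * q ^ 2) :
    Computes G w ((8 * D + 27) * T) host X host
      (fun a r => Finset.univ.biUnion fun p => (X a p).filter fun e => dest e = r) := by
  have code' : E ↪ (Fin w → Bool) :=
    Function.Embedding.trans ⟨fun e => (e, (0, 0)), fun e e' h => (Prod.ext_iff.1 h).1⟩ code
  set lab : E → Fin q := fun e => (dest e).1 with hlab
  set mem : E → Fin q := fun e => (dest e).2 with hmem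
  set X₁ : A → Fin q × Fin q → Finset E := fun a => shuffle (fun _ S e => dealTwice q S lab e) (X a) with hX₁
  set X₂ : A → Fin q × Fin q → Finset E := fun a => shuffle (fun p S e => (p.1, deal q S lab e)) (X₁ a)
    with hX₂
  set X₃ : A → Fin q × Fin q → Finset E := fun a => shuffle (fun _ S e => (lab e, deal q S lab e)) (X₂ a)
    with hX₃
  set X₄ : A → Fin q × Fin q → Finset E := fun a => shuffle (fun p S e => (p.1, deal q S mem e)) (X₃ a)
    with hX₄
  set X₅ : A → Fin q × Fin q → Finset E := fun a => shuffle (fun p S e => (p.1, mem e)) (X₄ a) with hX₅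
  -- A group consists of `q` destinations, each receiving at most `D * q ^ 2` tokens.
  have hgroup : ∀ a g, ∑ p, ((X a p).filter fun e => lab e = g).card ≤ D * q ^ 3 := by
    intro a g
    have e₁ : ∀ p, ((X a p).filter fun e => lab e = g).card =
        ∑ b, ((X a p).filter fun e => dest e = (g, b)).card := by
      intro p
      rw [← sum_card_filter_and (X a p) _ mem]
      refine Finset.sum_congr rfl fun b _ => ?_
      congr 1
      ext e
      simp only [Finset.mem_filter, Prod.ext_iff (x := dest e), hlab, hmem]
      tauto
    simp only [e₁]
    rw [Finset.sum_comm]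
    refine (Finset.sum_le_sum fun b _ => hrec a (g, b)).trans (le_of_eq ?_)
    simp
    ring
  -- spread the tokens for each group of destinations over all groups
  have load₁ : ∀ a p r, ((X a p).filter fun e => dealTwice q (X a p) lab e = r).card ≤ D + 2 :=
    fun a p r => dealTwice_card_le (hsend a p) r
  have c₁ : Computes G w ((D + 2) * T) host X host X₁ := computes_shuffle h code' _ X _ load₁
  have card₁ : ∀ a p, (X₁ a p).card ≤ (D + 2) * q ^ 2 := by
    intro a p
    refine (card_shuffle_le _ (X a) p).trans ?_
    refine (Finset.sum_le_sum fun p' _ => load₁ a p' p).trans (le_of_eq ?_)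
    simp
    ring
  have sum₁ : ∀ a x g, ∑ b, ((X₁ a (x, b)).filter fun e => lab e = g).card ≤ (D + 1) * q ^ 2 :=
    fun a x g => sum_dealTwice_card_le (hgroup a) x g
  -- balance the tokens for each group of destinations within each group
  have c₂ : Computes G w ((2 * (D + 3) + 2) * T) host X₁ host X₂ :=
    computes_shuffle_in_group h code (fun _ S e => deal q S lab e) X₁ (D + 3)
      fun a p b => deal_card_le (card₁ a p) b
  have card₂ : ∀ a p g, ((X₂ a p).filter fun e => lab e = g).card ≤ (D + 2) * q :=
    fun a p g => sum_deal_card_le (sum₁ a p.1 g) p.2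
  -- send the tokens to their groups
  have load₃ : ∀ a p r, ((X₂ a p).filter fun e => (lab e, deal q (X₂ a p) lab e) = r).card ≤
      D + 3 := by
    intro a p r
    refine le_of_mul_le_mul_add (q := q) (le_trans ?_ (Nat.add_le_add_right (card₂ a p r.1) q))
    simpa only [Prod.ext_iff] using deal_spec q (X₂ a p) lab r.1 r.2
  have c₃ : Computes G w ((D + 3) * T) host X₂ host X₃ := computes_shuffle h code' _ X₂ _ load₃
  have card₃ : ∀ a p, (X₃ a p).card ≤ (D + 3) * q ^ 2 := by
    intro a p
    refine (card_shuffle_le _ (X₂ a) p).trans ?_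
    refine (Finset.sum_le_sum fun p' _ => load₃ a p' p).trans (le_of_eq ?_)
    simp
    ring
  have lab₃ : ∀ a p, ∀ e ∈ X₃ a p, lab e = p.1 := by
    intro a p e he
    obtain ⟨p', -, rfl⟩ := mem_shuffle.1 he
    rfl
  have sum₃ : ∀ a x g, ∑ b, ((X₃ a (x, b)).filter fun e => mem e = g).card ≤ D * q ^ 2 := by
    intro a x g
    calc _ ≤ ∑ b, ((X₃ a (x, b)).filter fun e => dest e = (x, g)).card := by
          refine Finset.sum_le_sum fun b _ => Finset.card_le_card fun e he => ?_
          rw [Finset.mem_filter] at he ⊢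
          exact ⟨he.1, Prod.ext_iff.2 ⟨lab₃ a (x, b) e he.1, he.2⟩⟩
      _ ≤ ∑ p, ((X₃ a p).filter fun e => dest e = (x, g)).card := by
          rw [Fintype.sum_prod_type]
          exact Finset.single_le_sum
            (f := fun y => ∑ b, ((X₃ a (y, b)).filter fun e => dest e = (x, g)).card)
            (fun _ _ => Nat.zero_le _) (Finset.mem_univ x)
      _ ≤ ∑ p, ((X₂ a p).filter fun e => dest e = (x, g)).card := sum_card_filter_shuffle_le _ _ _
      _ ≤ ∑ p, ((X₁ a p).filter fun e => dest e = (x, g)).card := sum_card_filter_shuffle_le _ _ _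
      _ ≤ ∑ p, ((X a p).filter fun e => dest e = (x, g)).card := sum_card_filter_shuffle_le _ _ _
      _ ≤ _ := hrec a (x, g)
  -- balance the tokens for each node within its group, and deliver them
  have c₄ : Computes G w ((2 * (D + 4) + 2) * T) host X₃ host X₄ :=
    computes_shuffle_in_group h code (fun _ S e => deal q S mem e) X₃ (D + 4)
      fun a p b => deal_card_le (card₃ a p) b
  have card₄ : ∀ a p g, ((X₄ a p).filter fun e => mem e = g).card ≤ (D + 1) * q :=
    fun a p g => sum_deal_card_le (sum₃ a p.1 g) p.2
  have lab₄ : ∀ a p, ∀ e ∈ X₄ a p, lab e = p.1 := by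
    intro a p e he
    obtain ⟨p', he', rfl⟩ := mem_shuffle.1 he
    exact lab₃ a p' e he'
  have c₅ : Computes G w ((2 * (D + 1) + 2) * T) host X₄ host X₅ :=
    computes_shuffle_in_group h code (fun _ _ e => mem e) X₄ (D + 1) card₄
  have dest₅ : ∀ a p, ∀ e ∈ X₅ a p, dest e = p := by
    intro a p e he
    obtain ⟨p', he', rfl⟩ := mem_shuffle.1 he
    exact Prod.ext (lab₄ a p' e he') rfl
  have all₅ : ∀ a e, (∃ p, e ∈ X₅ a p) ↔ ∃ p, e ∈ X a p := fun a e => by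
    simp only [hX₅, hX₄, hX₃, hX₂, hX₁, exists_mem_shuffle]
  have e₅ : X₅ = fun a r => Finset.univ.biUnion fun p => (X a p).filter fun e => dest e = r := by
    funext a r
    ext e
    simp only [Finset.mem_biUnion, Finset.mem_univ, true_and, Finset.mem_filter]
    constructor
    · intro he
      obtain ⟨p, hp⟩ := (all₅ a e).1 ⟨r, he⟩
      exact ⟨p, hp, dest₅ a r e he⟩
    · rintro ⟨p, hp, rfl⟩
      obtain ⟨r, hr⟩ := (all₅ a e).2 ⟨p, hp⟩
      rw [dest₅ a r e hr]
      exact hr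
  rw [← e₅]
  -- The five phases need `D + 2`, `2 * D + 8`, `D + 3`, `2 * D + 10` and `2 * D + 4` all-to-all
  -- exchanges, `8 * D + 27` in total.
  refine ((((c₁.trans c₂).trans c₃).trans c₄).trans c₅).mono (le_of_eq ?_)
  ring

end Route


/-! ## Core-periphery networks contain a clique of representatives -/

section Core

open scoped Classical

variable {V : Type} {G : SimpleGraph V} {C : Set V} {β γ : ℕ}

/-- Diagonal pairs are added at no cost, as their messages never move; routing then needs no special
case for tokens that stay at a node. -/
theorem IsCliqueEmulator.canDeliver (h : IsCliqueEmulator (G.induce C) β) :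
    CanDeliver G (fun i : C × C => (i.1 : V)) (fun i => {(i.2 : V)}) β := by
  obtain ⟨p, p0, pT, ps, pi⟩ := h
  refine ⟨fun i t => if h : i.1 ≠ i.2 then (p ⟨i, h⟩ t : V) else i.1, fun i => ?_, fun i => ?_,
    fun i t ht => ?_, fun i j t ht h1 h2 h3 => ?_⟩
  · by_cases h : i.1 ≠ i.2
    · simp [h, p0 ⟨i, h⟩]
    · simp [h]
  · by_cases h : i.1 ≠ i.2
    · have := pT ⟨i, h⟩
      simp only [Set.mem_singleton_iff] at this
      simp [h, this]
    · simp only [ne_eq, not_not] at h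
      simp [h]
  · by_cases h : i.1 ≠ i.2
    · simp only [h, dif_pos, ne_eq, not_false_eq_true]
      rcases ps ⟨i, h⟩ t ht with h' | h'
      · exact .inl (congrArg Subtype.val h')
      · exact .inr h'
    · simp [h]
  · by_cases hi : i.1 ≠ i.2
    · by_cases hj : j.1 ≠ j.2
      · simp only [hi, hj, dif_pos, ne_eq, not_false_eq_true] at h1 h2 h3
        exact congrArg Subtype.val (pi ⟨i, hi⟩ ⟨j, hj⟩ t ht (Subtype.ext h1) (Subtype.ext h2)
          fun e => h3 (congrArg Subtype.val e))
      · rw [h1, h2] at h3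
        simp [hj] at h3
    · simp [hi] at h3

theorem exists_last_arrival {p : ℕ → V} {u : V} {T : ℕ} (h0 : p 0 ≠ u) (hT : p T = u) :
    ∃ t < T, p t ≠ u ∧ p (t + 1) = u := by
  induction T with
  | zero => exact absurd hT h0
  | succ T ih =>
    by_cases h : p T = u
    · obtain ⟨t, ht, h'⟩ := ih h
      exact ⟨t, ht.trans (Nat.lt_succ_self T), h'⟩
    · exact ⟨T, Nat.lt_succ_self T, h, hT⟩

/-- The number of messages received by `u` in a convergecast is limited by its degree. -/
theorem IsConvergecaster.exists_representative [Fintype V] (h : IsConvergecaster G Cᶜ C γ) :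
    ∃ rep : V → C, CanDeliver G (fun v => v) (fun v => {(rep v : V)}) γ ∧
      ∀ u : C, (Finset.univ.filter fun v => rep v = u).card ≤
        γ * (G.neighborSet u).ncard + 1 := by
  obtain ⟨p, p0, pT, ps, pi⟩ := h
  -- Core nodes represent themselves; this accounts for the `+ 1` in the bound.
  let r : V → ℕ → V := fun v t => if h : v ∈ C then v else p ⟨v, h⟩ t
  have rC : ∀ v ∈ C, ∀ t, r v t = v := fun v hv t => by simp [r, hv]
  have rP : ∀ v (hv : v ∉ C) t, r v t = p ⟨v, hv⟩ t := fun v hv t => by simp [r, hv]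
  have rT : ∀ v, r v γ ∈ C := by
    intro v
    by_cases hv : v ∈ C
    · rw [rC v hv]; exact hv
    · rw [rP v hv]; exact pT _
  have r0 : ∀ v, r v 0 = v := by
    intro v
    by_cases hv : v ∈ C
    · rw [rC v hv]
    · rw [rP v hv, p0]
  have rs : ∀ v, ∀ t < γ, r v (t + 1) = r v t ∨ G.Adj (r v t) (r v (t + 1)) := by
    intro v t ht
    by_cases hv : v ∈ C
    · rw [rC v hv, rC v hv]; exact .inl rfl
    · rw [rP v hv, rP v hv]; exact ps _ t ht
  have ri : ∀ v v', ∀ t < γ, r v t = r v' t → r v (t + 1) = r v' (t + 1) →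
      r v (t + 1) ≠ r v t → v = v' := by
    intro v v' t ht h1 h2 h3
    by_cases hv : v ∈ C
    · exact absurd ((rC v hv _).trans (rC v hv _).symm) h3
    by_cases hv' : v' ∈ C
    · rw [h1, h2] at h3
      exact absurd ((rC v' hv' _).trans (rC v' hv' _).symm) h3
    · rw [rP v hv, rP v' hv'] at h1 h2
      rw [rP v hv, rP v hv] at h3
      exact congrArg Subtype.val (pi _ _ t ht h1 h2 h3)
  refine ⟨fun v => ⟨r v γ, rT v⟩, ⟨r, r0, fun v => rfl, rs, ri⟩, fun u => ?_⟩
  have arr : ∀ v : V, ∃ t, v ∉ C → r v γ = u → t < γ ∧ r v t ≠ u ∧ r v (t + 1) = u := by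
    intro v
    by_cases hv : v ∉ C ∧ r v γ = u
    · have h0 : r v 0 ≠ u := by
        rw [r0]
        rintro rfl
        exact hv.1 u.2
      obtain ⟨t, ht⟩ := exists_last_arrival h0 hv.2
      exact ⟨t, fun _ _ => ht⟩
    · exact ⟨0, fun h1 h2 => absurd ⟨h1, h2⟩ hv⟩
  choose τ hτ using arr
  have hsub : (Finset.univ.filter fun v => (⟨r v γ, rT v⟩ : C) = u) ⊆
      insert (u : V) (Finset.univ.filter fun v => v ∉ C ∧ r v γ = u) := by
    intro v hv
    have hv' : r v γ = u := congrArg Subtype.val (Finset.mem_filter.1 hv).2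
    by_cases hC : v ∈ C
    · rw [rC v hC] at hv'
      simp [hv']
    · simp [hC, hv']
  refine (Finset.card_le_card hsub).trans ((Finset.card_insert_le _ _).trans
    (Nat.add_le_add_right ?_ 1))
  have hcard : (Finset.range γ ×ˢ (G.neighborSet u).toFinset).card =
      γ * (G.neighborSet u).ncard := by
    rw [Finset.card_product, Finset.card_range, Set.ncard_eq_toFinset_card']
  rw [← hcard]
  -- A message is determined by a time at which it enters `u` and the neighbour it comes from,
  -- because an edge carries one message per round.
  refine Finset.card_le_card_of_injOn (fun v => (τ v, r v (τ v))) ?_ ?_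
  · intro v hv
    obtain ⟨hv1, hv2⟩ := (Finset.mem_filter.1 hv).2
    obtain ⟨h1, h2, h3⟩ := hτ v hv1 hv2
    have hadj := (rs v _ h1).resolve_left fun e => h2 (e ▸ h3)
    rw [h3] at hadj
    simp [h1, hadj.symm]
  · intro v hv v' hv' e
    obtain ⟨hv1, hv2⟩ := (Finset.mem_filter.1 hv).2
    obtain ⟨hv1', hv2'⟩ := (Finset.mem_filter.1 hv').2
    obtain ⟨h1, h2, h3⟩ := hτ v hv1 hv2
    obtain ⟨-, -, h3'⟩ := hτ v' hv1' hv2'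
    obtain ⟨e1, e2⟩ := Prod.ext_iff.1 e
    simp only at e1 e2
    rw [← e1] at e2 h3'
    exact ri v v' _ h1 e2 (h3.trans h3'.symm) fun e => h2 (e ▸ h3)

/-- Since `u` is not its own neighbour, its inner degree plus one is at most `|C|`; the outer degree
is at most `⌈α⌉₊` times that. -/
theorem HasBalancedBoundary.ncard_neighborSet_le [Finite V] {α : ℝ}
    (h : HasBalancedBoundary G C α) {u : V} (hu : u ∈ C) :
    (G.neighborSet u).ncard ≤ (⌈α⌉₊ + 1) * C.ncard := by
  have h1 : (G.neighborSet u ∩ C).ncard + 1 ≤ C.ncard := by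
    rw [← Set.ncard_insert_of_notMem (a := u) (fun hn => G.loopless.irrefl u hn.1)]
    refine Set.ncard_le_ncard ?_
    rw [Set.insert_subset_iff]
    exact ⟨hu, Set.inter_subset_right⟩
  have h2 : (G.neighborSet u \ C).ncard ≤ ⌈α⌉₊ * ((G.neighborSet u ∩ C).ncard + 1) := by
    have h3 := h u hu
    rw [div_le_iff₀ (by positivity)] at h3
    have h4 : ((G.neighborSet u \ C).ncard : ℝ) ≤
        ⌈α⌉₊ * ((G.neighborSet u ∩ C).ncard + 1) :=
      h3.trans (mul_le_mul_of_nonneg_right (Nat.le_ceil α) (by positivity))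
    exact_mod_cast h4
  rw [← Set.ncard_inter_add_ncard_sdiff_eq_ncard (G.neighborSet u) C]
  have h5 := Nat.mul_le_mul_left ⌈α⌉₊ h1
  linarith

/-- A core-periphery network contains a clique of `q ^ 2` hosts, each of which serves `O(q ^ 2)`
nodes, where all nodes can communicate with their hosts in time `O(1)`. -/
theorem IsCPNetwork.exists_hosts [Fintype V] [Nonempty V] {α : ℝ} (h : IsCPNetwork G C α β γ)
    {L : ℕ} (hL : L = 4 * (γ * (⌈α⌉₊ + 1) + 1) + 1) :
    ∃ (q : ℕ) (_ : NeZero q) (host : Fin q × Fin q → V) (srv : V → Fin q × Fin q),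
      q * q ≤ Fintype.card V ∧
      (∀ p, (Finset.univ.filter fun v => srv v = p).card ≤ 4 * L * q ^ 2) ∧
      CanDeliver G (fun v => v) (fun v => {host (srv v)}) (γ + L * β) ∧
      CanDeliver G (fun i : (Fin q × Fin q) × (Fin q × Fin q) => host i.1)
        (fun i => {host i.2}) β := by
  obtain ⟨rep, hrep, hcard⟩ := h.convergecast.exists_representative
  have hpairs := h.cliqueEmulation.canDeliver
  obtain ⟨v₀⟩ := ‹Nonempty V›
  have hm0 : 0 < C.ncard := (Set.ncard_pos (Set.toFinite C)).2 ⟨rep v₀, (rep v₀).2⟩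
  set m := C.ncard with hm
  have hfib : ∀ u : C, (Finset.univ.filter fun v => rep v = u).card ≤
      (γ * (⌈α⌉₊ + 1) + 1) * m := by
    intro u
    refine (hcard u).trans ?_
    have h1 := Nat.mul_le_mul_left γ (h.boundary.ncard_neighborSet_le u.2)
    rw [← hm] at h1
    nlinarith
  -- A square number of hosts is needed for the grid; at most a factor 4 is lost, as `m ≤ 4 * q ^
  -- 2`.
  set q := Nat.sqrt m with hq
  have hq0 : 0 < q := Nat.sqrt_pos.2 hm0
  have : NeZero q := ⟨hq0.ne'⟩
  have : NeZero (q * q) := ⟨(Nat.mul_pos hq0 hq0).ne'⟩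
  have hqm : q * q ≤ m := Nat.sqrt_le m
  have hmq : m ≤ 4 * q ^ 2 := by
    have h1 : m < (q + 1) * (q + 1) := Nat.lt_succ_sqrt m
    nlinarith
  have hmC : m = Fintype.card C := by rw [hm, ← Nat.card_coe_set_eq, Nat.card_eq_fintype_card]
  obtain ⟨emb⟩ : Nonempty (Fin q × Fin q ↪ C) := by
    rw [Function.Embedding.nonempty_iff_card_le, ← hmC]
    simpa using hqm
  -- Each representative deals its clients evenly over the hosts. With `M = γ * (⌈α⌉₊ + 1) + 1`, it
  -- has at most `M * m ≤ 4 * M * q ^ 2` clients, so at most `4 * M + 1 = L` of them go to any one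
  -- host.
  let r : V → Fin (q * q) := deal (q * q) Finset.univ rep
  let srv : V → Fin q × Fin q := fun v => finProdFinEquiv.symm (r v)
  have hload : ∀ u p, (Finset.univ.filter fun v => rep v = u ∧ srv v = p).card ≤ L := by
    intro u p
    have h1 := deal_spec (q * q) Finset.univ rep u (finProdFinEquiv p)
    have h2 : (Finset.univ.filter fun v => rep v = u ∧ srv v = p) =
        Finset.univ.filter fun v => rep v = u ∧
          deal (q * q) Finset.univ rep v = finProdFinEquiv p := by
      refine Finset.filter_congr fun v _ => ?_
      simp only [srv, r, Equiv.symm_apply_eq]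
    rw [h2]
    refine Nat.le_of_mul_le_mul_left (h1.trans ?_) (Nat.mul_pos hq0 hq0)
    have h3 := (hfib u).trans (Nat.mul_le_mul_left _ hmq)
    rw [hL]
    nlinarith
  refine ⟨q, ‹_›, fun p => emb p, srv, ?_, fun p => ?_, ?_, ?_⟩
  · have h1 : m ≤ Fintype.card V := by
      rw [hmC]
      exact Fintype.card_subtype_le _
    exact hqm.trans h1
  · rw [← sum_card_filter_and _ _ rep]
    refine (Finset.sum_le_sum fun u _ => hload u p).trans ?_
    rw [Finset.sum_const, smul_eq_mul, Finset.card_univ, ← hmC]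
    nlinarith
  · refine hrep.trans ?_
    refine hpairs.of_card_le (fun v => (rep v, emb (srv v))) fun i => ?_
    by_cases hi : ∃ p, emb p = i.2
    · obtain ⟨p, hp⟩ := hi
      refine (Finset.card_le_card ?_).trans (hload i.1 p)
      intro v hv
      simp only [Finset.mem_filter, Prod.ext_iff (y := i)] at hv ⊢
      exact ⟨hv.1, hv.2.1, emb.injective (hv.2.2.trans hp.symm)⟩
    · rw [Finset.filter_eq_empty_iff.2]
      · simp
      · rintro v - rfl
        exact hi ⟨_, rfl⟩
  · exact hpairs.comp_injective (fun i : (Fin q × Fin q) × (Fin q × Fin q) => (emb i.1, emb i.2)) fun i j hij => by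
      simp only [Prod.mk.injEq, EmbeddingLike.apply_eq_iff_eq] at hij
      exact Prod.ext hij.1 hij.2

end Core


/-! ## Routing on core-periphery networks -/

section Network

open scoped Classical

/-- The number of rounds in which every node can send and receive a bounded number of messages. -/
theorem exists_routing_time (α : ℝ) (β γ : ℕ) : ∃ K : ℕ,
    ∀ (V : Type) [Fintype V] [Nonempty V] (G : SimpleGraph V) (C : Set V),
      IsCPNetwork G C α β γ → ∀ (A E : Type) [DecidableEq E] (w : ℕ), Nonempty (E × V ↪ (Fin w → Bool)) →
      ∀ (dest : E → V) (X : A → V → Finset E) (D : ℕ), (∀ a v, (X a v).card ≤ D) →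
      (∀ a u, ∑ v, ((X a v).filter fun e => dest e = u).card ≤ D) →
      Computes G w (K * (D + 1)) (fun v => v) X (fun v => v)
        (fun a u => Finset.univ.biUnion fun v => (X a v).filter fun e => dest e = u) := by
  set L := 4 * (γ * (⌈α⌉₊ + 1) + 1) + 1 with hL
  refine ⟨2 * (γ + L * β) + (8 * (4 * L) + 27) * β, ?_⟩
  intro V _ _ G C hG A E _ w hcode dest X D hsend hrec
  obtain ⟨code⟩ := hcode
  obtain ⟨q, _, host, srv, hq, hsrv, hin, hclique⟩ := hG.exists_hosts hL
  have hout := hin.reverse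
  obtain ⟨emb⟩ : Nonempty (Fin q × Fin q ↪ V) := by
    rw [Function.Embedding.nonempty_iff_card_le]
    simpa using hq
  -- There are at most as many hosts as nodes, so a host address fits wherever a node address does.
  have codeP : E × (Fin q × Fin q) ↪ (Fin w → Bool) :=
    (Function.Embedding.prodMap (Function.Embedding.refl E) emb).trans code
  have codeE : E ↪ (Fin w → Bool) :=
    Function.Embedding.trans
      ⟨fun e => (e, Classical.arbitrary V), fun e e' h => (Prod.ext_iff.1 h).1⟩ code
  let Z : A → Fin q × Fin q → Finset E := fun a p =>
    (Finset.univ.filter fun v => srv v = p).biUnion (X a)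
  have c₁ : Computes G w (D * (γ + L * β)) (fun v => v) X host Z :=
    hin.computes_ship (fr := fun v => v) (tgt := srv) codeE X X (fun _ S => S) (fun _ _ => rfl) D
      hsend
  have hZ : ∀ a p, (Z a p).card ≤ 4 * L * D * q ^ 2 := by
    intro a p
    refine Finset.card_biUnion_le.trans ((Finset.sum_le_sum fun v _ => hsend a v).trans ?_)
    rw [Finset.sum_const, smul_eq_mul]
    refine (Nat.mul_le_mul_right D (hsrv p)).trans (le_of_eq ?_)
    ring
  have hZ' : ∀ a r, ∑ p, ((Z a p).filter fun e => srv (dest e) = r).card ≤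
      4 * L * D * q ^ 2 := by
    intro a r
    calc _ ≤ ∑ p, ∑ v ∈ Finset.univ.filter (fun v => srv v = p),
            ((X a v).filter fun e => srv (dest e) = r).card := by
          refine Finset.sum_le_sum fun p _ => ?_
          simp only [Z, Finset.filter_biUnion]
          exact Finset.card_biUnion_le
      _ = ∑ v, ((X a v).filter fun e => srv (dest e) = r).card :=
          Finset.sum_fiberwise _ _ _
      _ ≤ ∑ v, ∑ u ∈ Finset.univ.filter (fun u => srv u = r),
            ((X a v).filter fun e => dest e = u).card := by
          refine Finset.sum_le_sum fun v _ => ?_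
          refine le_trans (Finset.card_le_card ?_) Finset.card_biUnion_le
          intro e he
          simpa [and_comm] using he
      _ = ∑ u ∈ Finset.univ.filter (fun u => srv u = r),
            ∑ v, ((X a v).filter fun e => dest e = u).card := Finset.sum_comm
      _ ≤ ∑ u ∈ Finset.univ.filter (fun u => srv u = r), D :=
          Finset.sum_le_sum fun u _ => hrec a u
      _ ≤ 4 * L * D * q ^ 2 := by
          rw [Finset.sum_const, smul_eq_mul]
          refine (Nat.mul_le_mul_right D (hsrv r)).trans (le_of_eq ?_)
          ring
  have c₂ := computes_route_clique hclique codeP (fun e => srv (dest e)) Z (4 * L * D) hZ hZ'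
  have c₃ := hout.computes_ship (fr := srv) (tgt := fun v => v) (t := fun v => v) codeE
    (fun a r => Finset.univ.biUnion fun p => (Z a p).filter fun e => srv (dest e) = r)
    (fun a u => Finset.univ.biUnion fun v => (X a v).filter fun e => dest e = u)
    (fun u S => S.filter fun e => dest e = u)
    (fun a u => by
      ext e
      simp only [Finset.mem_biUnion, Finset.mem_univ, true_and, Finset.mem_filter, Z]
      constructor
      · rintro ⟨v, he, rfl⟩
        exact ⟨⟨srv v, ⟨v, rfl, he⟩, rfl⟩, rfl⟩
      · rintro ⟨⟨-, ⟨v, -, he⟩, -⟩, rfl⟩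
        exact ⟨v, he, rfl⟩)
    D (fun a u => Finset.card_biUnion_le.trans (hrec a u))
  have c₄ : Computes G w (D * (γ + L * β) + (8 * (4 * L * D) + 27) * β + D * (γ + L * β))
      (fun v => v) X (fun v => v)
      (fun a u => Finset.univ.biUnion fun v => (X a v).filter fun e => dest e = u) := by
    convert (c₁.trans c₂).trans c₃ using 3 with a u
    ext e
    simp
  refine c₄.mono ?_
  nlinarith [Nat.zero_le (γ + L * β), Nat.zero_le β, Nat.zero_le (D * β)]

/-- The transposition of arrays of integers `x u v y`, which are sparse in the sense that there are
at most `D` nonzero elements for each `u` and for each `v`. -/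
theorem exists_exchange_time (α : ℝ) (β γ : ℕ) : ∃ K : ℕ,
    ∀ (V : Type) [Fintype V] [Nonempty V] (G : SimpleGraph V) (C : Set V),
      IsCPNetwork G C α β γ → ∀ (A Y S O : Type) [Fintype Y] (w N : ℕ),
      Nonempty ((V × V × Y × Finset.Icc (-N : ℤ) N) × V ↪ (Fin w → Bool)) →
      ∀ (s : A → V → S) (x : A → V → V → Y → ℤ) (f : V → S → V → Y → ℤ)
        (y : A → V → O) (g : V → S → (V → Y → ℤ) → O) (D : ℕ),
      (∀ a u v i, x a u v i = f u (s a u) v i) →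
      (∀ a v, y a v = g v (s a v) fun u => x a u v) →
      (∀ a u v i, |x a u v i| ≤ N) →
      (∀ a u, (Finset.univ.filter fun p : V × Y => x a u p.1 p.2 ≠ 0).card ≤ D) →
      (∀ a v, (Finset.univ.filter fun p : V × Y => x a p.1 v p.2 ≠ 0).card ≤ D) →
      Computes G w (K * (D + 1)) (fun v => v) s (fun v => v) y := by
  obtain ⟨K, hK⟩ := exists_routing_time α β γ
  refine ⟨K, ?_⟩
  intro V _ _ G C hG A Y S O _ w N hcode s x f y g D hf hg hx hsend hrec
  let E := V × V × Y × Finset.Icc (-N : ℤ) N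
  -- A token records target, source, index and value. Only nonzero values are sent, and the receiver
  -- reads a missing token as 0; hence loads count nonzero entries only.
  let tok : V → (V → Y → ℤ) → Finset E := fun u z =>
    Finset.univ.filter fun e => e.2.1 = u ∧ z e.1 e.2.2.1 = e.2.2.2 ∧ (e.2.2.2 : ℤ) ≠ 0
  have mem_tok : ∀ u z (e : E), e ∈ tok u z ↔
      e.2.1 = u ∧ z e.1 e.2.2.1 = e.2.2.2 ∧ (e.2.2.2 : ℤ) ≠ 0 := fun u z e => by
    simp [tok]
  let X : A → V → Finset E := fun a u => tok u (x a u)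
  have hX : ∀ a u, (X a u).card ≤ D := by
    intro a u
    refine (Finset.card_le_card_of_injOn (fun e : E => (e.1, e.2.2.1)) ?_ ?_).trans (hsend a u)
    · intro e he
      obtain ⟨-, h2, h3⟩ := (mem_tok _ _ _).1 (Finset.mem_coe.1 he)
      simp [h2, h3]
    · intro e he e' he' h
      obtain ⟨h1, h2, -⟩ := (mem_tok _ _ _).1 (Finset.mem_coe.1 he)
      obtain ⟨h1', h2', -⟩ := (mem_tok _ _ _).1 (Finset.mem_coe.1 he')
      obtain ⟨e1, e2⟩ := Prod.ext_iff.1 h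
      simp only at e1 e2
      rw [e1, e2] at h2
      exact Prod.ext e1 (Prod.ext (h1.trans h1'.symm)
        (Prod.ext e2 (Subtype.ext (h2.symm.trans h2'))))
  have hX' : ∀ a v, ∑ u, ((X a u).filter fun e => e.1 = v).card ≤ D := by
    intro a v
    rw [← Finset.card_sigma]
    refine (Finset.card_le_card_of_injOn
      (fun e : (_ : V) × E => (e.2.2.1, e.2.2.2.1)) ?_ ?_).trans (hrec a v)
    · rintro ⟨u, e⟩ he
      rw [Finset.mem_coe, Finset.mem_sigma, Finset.mem_filter, mem_tok] at he
      obtain ⟨-, ⟨h1, h2, h3⟩, h4⟩ := he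
      simp only at h1 h2 h3 h4
      rw [h4, ← h1] at h2
      simp [h2, h3]
    · rintro ⟨u, e⟩ he ⟨u', e'⟩ he' h
      rw [Finset.mem_coe, Finset.mem_sigma, Finset.mem_filter, mem_tok] at he he'
      obtain ⟨-, ⟨h1, h2, -⟩, h4⟩ := he
      obtain ⟨-, ⟨h1', h2', -⟩, h4'⟩ := he'
      obtain ⟨e1, e2⟩ := Prod.ext_iff.1 h
      simp only at h1 h2 h4 h1' h2' h4' e1 e2
      subst h1 h1'
      rw [h4, e1, e2] at h2
      rw [h4'] at h2'
      have : e = e' := Prod.ext (h4.trans h4'.symm) (Prod.ext e1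
        (Prod.ext e2 (Subtype.ext (h2.symm.trans h2'))))
      rw [this]
  have c₁ : Computes G w 0 (fun v : V => v) s (fun v => v) X :=
    computes_map (fun u z => tok u (f u z)) fun a u => by
      simp only [X]
      congr 1
      funext v i
      exact hf a u v i
  have c₂ := (c₁.trans (hK V G C hG A E w hcode (fun e => e.1) X D hX hX')).frame
  have c₃ := c₂.trans (computes_map (y := y)
    (fun v z => g v z.1 fun u i => if h : ∃ e ∈ z.2, e.2.1 = u ∧ e.2.2.1 = i then
      (h.choose.2.2.2 : ℤ) else 0) fun a v => by
    rw [hg]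
    congr 1
    funext u i
    split_ifs with h
    · obtain ⟨h1, h2, h3⟩ := h.choose_spec
      rw [Finset.mem_biUnion] at h1
      obtain ⟨u', -, h1⟩ := h1
      rw [Finset.mem_filter, mem_tok] at h1
      obtain ⟨⟨h4, h5, -⟩, h6⟩ := h1
      rw [← h5, h6, h3, ← h4, h2]
    · by_contra hne
      apply h
      have hb : x a u v i ∈ Finset.Icc (-N : ℤ) N := Finset.mem_Icc.2 (abs_le.1 (hx a u v i))
      refine ⟨(v, u, i, ⟨x a u v i, hb⟩), ?_, rfl, rfl⟩
      rw [Finset.mem_biUnion]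
      refine ⟨u, Finset.mem_univ _, ?_⟩
      rw [Finset.mem_filter, mem_tok]
      exact ⟨⟨rfl, rfl, hne⟩, rfl⟩)
  exact c₃.mono (by simp)

end Network


/-! ## Multiplication of sparse matrices -/

theorem Computes.learns {V A I O : Type} [Inhabited O] {G : SimpleGraph V} {w T : ℕ}
    {x : A → V → I} {y : A → V → O} (h : Computes G w T (fun v => v) x (fun v => v) y) :
    Learns G w y T x := by
  classical
  have h₁ := Learns.of_local (κ₀ := x) h (fun v i j => if j = v then some i else none)
    fun a v => by
      funext j
      by_cases hj : j = v <;> simp [localView, hj]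
  have h₂ : Learns G w y 0 (fun a => localView (fun v => v) (y a)) :=
    ⟨fun v m => (m v).getD default, fun a v => by simp [localView]⟩
  exact h₂.trans h₁

/-- Correctness for all seeds means probability 1, whatever the exponent `a`. -/
theorem le_successProb {V I O : Type} [Finite V] {w : ℕ} (alg : CongestAlgorithm V I O w)
    (G : SimpleGraph V) (input : V → I) (target : V → O) (T : ℕ)
    (h : ∀ coin v, alg.output v (alg.run G input coin T v) = target v) (n a : ℕ) :
    1 - 1 / (n : ℝ) ^ a ≤ alg.successProb G input target T := by
  have := alg.finiteCoin
  have := alg.nonemptyCoin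
  have h₁ : alg.successProb G input target T = 1 := by
    rw [CongestAlgorithm.successProb, Nat.card_congr (Equiv.subtypeUnivEquiv fun coin => h coin)]
    exact div_self (Nat.cast_ne_zero.2 Nat.card_pos.ne')
  rw [h₁]
  have : (0 : ℝ) ≤ 1 / (n : ℝ) ^ a := by positivity
  linarith

/-! ### Numbers and sizes of nonzero entries and products. -/

section Sparse

variable {n s : ℕ} {A B : Matrix (Fin n) (Fin n) ℤ}

theorem IsSparse.row_card_le (h : IsSparse A s) (i : Fin n) :
    (Finset.univ.filter fun j => A i j ≠ 0).card ≤ s := by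
  rw [← Set.ncard_coe_finset]
  simpa using h.1 i

theorem IsSparse.col_card_le (h : IsSparse A s) (j : Fin n) :
    (Finset.univ.filter fun i => A i j ≠ 0).card ≤ s := by
  rw [← Set.ncard_coe_finset]
  simpa using h.2 j

/-- This bounds the products received by the node in charge of row `i`. -/
theorem card_row_pairs_le (hA : IsSparse A s) (hB : IsSparse B s) (i : Fin n) :
    (Finset.univ.filter fun p : Fin n × Fin n => A i p.1 ≠ 0 ∧ B p.1 p.2 ≠ 0).card ≤ s * s := by
  have h : (Finset.univ.filter fun p : Fin n × Fin n => A i p.1 ≠ 0 ∧ B p.1 p.2 ≠ 0).card ≤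
      ((Finset.univ.filter fun j => A i j ≠ 0).sigma
        fun j => Finset.univ.filter fun l => B j l ≠ 0).card :=
    Finset.card_le_card_of_injOn (fun p => ⟨p.1, p.2⟩) (fun p hp => by simpa using hp)
      fun p _ p' _ h => by simpa [Prod.ext_iff] using h
  rw [Finset.card_sigma] at h
  refine h.trans ((Finset.sum_le_sum fun j _ => hB.row_card_le j).trans ?_)
  rw [Finset.sum_const, smul_eq_mul]
  exact Nat.mul_le_mul_right s (hA.row_card_le i)

/-- This bounds the products sent by the node in charge of the inner index `j`. -/
theorem card_col_row_pairs_le (hA : IsSparse A s) (hB : IsSparse B s) (j : Fin n) :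
    (Finset.univ.filter fun p : Fin n × Fin n => A p.1 j ≠ 0 ∧ B j p.2 ≠ 0).card ≤ s * s := by
  have h : (Finset.univ.filter fun p : Fin n × Fin n => A p.1 j ≠ 0 ∧ B j p.2 ≠ 0) =
      (Finset.univ.filter fun i => A i j ≠ 0) ×ˢ (Finset.univ.filter fun l => B j l ≠ 0) := by
    ext p
    simp
  rw [h, Finset.card_product]
  exact Nat.mul_le_mul (hA.col_card_le j) (hB.row_card_le j)

theorem mul_row_card_le (hA : IsSparse A s) (hB : IsSparse B s) (i : Fin n) :
    (Finset.univ.filter fun l => (A * B) i l ≠ 0).card ≤ s * s := by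
  refine le_trans (Finset.card_le_card ?_)
    ((Finset.card_image_le (f := Prod.snd)).trans (card_row_pairs_le hA hB i))
  intro l hl
  have hl' : ∑ j, A i j * B j l ≠ 0 := (Finset.mem_filter.1 hl).2
  obtain ⟨j, -, hj⟩ := Finset.exists_ne_zero_of_sum_ne_zero hl'
  exact Finset.mem_image.2 ⟨(j, l), by simpa using hj, rfl⟩

theorem abs_mul_apply_le {e : ℕ} (hA : HasSmallEntries A e) (hB : HasSmallEntries B e)
    (i l : Fin n) : |(A * B) i l| ≤ (n : ℤ) ^ (2 * e + 1) := by
  rw [Matrix.mul_apply]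
  refine (Finset.abs_sum_le_sum_abs _ _).trans ?_
  refine (Finset.sum_le_card_nsmul _ _ ((n : ℤ) ^ (2 * e)) fun j _ => ?_).trans (le_of_eq ?_)
  · rw [abs_mul, two_mul, pow_add]
    exact mul_le_mul (hA i j) (hB j l) (abs_nonneg _) (by positivity)
  · simp
    ring

end Sparse

/-- Three node addresses and an index give at most `n ^ 4` choices. There are `2 * m + 1 ≤ n ^ 2 *
m` values, where `m = n ^ (2 * e + 1)` bounds all entries of the product. Together this is at most
`n ^ (2 * e + 7)`. -/
theorem nonempty_code {n e b : ℕ} (hn : 2 ≤ n) {V Y : Type} [Fintype V] [Fintype Y]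
    (hV : Fintype.card V = n) (hY : Fintype.card Y ≤ n) (hb : b = 2 * e + 7) :
    Nonempty ((V × V × Y × Finset.Icc (-((n ^ (2 * e + 1) : ℕ)) : ℤ) ((n ^ (2 * e + 1) : ℕ) : ℤ)) × V ↪
      (Fin (b * Nat.clog 2 n) → Bool)) := by
  classical
  rw [Function.Embedding.nonempty_iff_card_le]
  have h₁ : n ^ b ≤ 2 ^ (b * Nat.clog 2 n) := by
    rw [mul_comm, pow_mul]
    exact Nat.pow_le_pow_left (Nat.le_pow_clog (by norm_num) n) b
  simp only [Fintype.card_prod, Fintype.card_fun, Fintype.card_bool, Fintype.card_fin, hV,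
    Fintype.card_coe, Int.card_Icc]
  refine le_trans ?_ h₁
  have h₂ : 1 ≤ n ^ (2 * e + 1) := Nat.one_le_pow _ _ (by omega)
  have h₃ : ((((n ^ (2 * e + 1) : ℕ) : ℤ) + 1 - -((n ^ (2 * e + 1) : ℕ) : ℤ)).toNat) ≤
      n ^ 2 * n ^ (2 * e + 1) := by
    have h₄ : 4 ≤ n ^ 2 := by nlinarith
    have h₅ := Nat.mul_le_mul_right (n ^ (2 * e + 1)) h₄
    generalize n ^ (2 * e + 1) = m at *
    omega
  calc _ ≤ n * (n * (n * (n ^ 2 * n ^ (2 * e + 1)))) * n := by gcongr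
    _ = n ^ b := by rw [hb]; ring

/-- The possible inputs of sparse matrix multiplication. -/
structure SparseInput (V : Type) (n s e : ℕ) where
  A : Matrix (Fin n) (Fin n) ℤ
  B : Matrix (Fin n) (Fin n) ℤ
  σA : V ≃ Fin n
  σB : V ≃ Fin n
  sparseA : IsSparse A s
  sparseB : IsSparse B s
  smallA : HasSmallEntries A e
  smallB : HasSmallEntries B e

/-- Five exchanges suffice: columns of `A`, rows of `B`, requests for product rows, elementary
products, and finished rows. Requests are needed because the distribution of rows is arbitrary and
not known globally. -/
theorem exists_multiplication_time (α : ℝ) (β γ : ℕ) : ∃ K : ℕ,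
    ∀ (V : Type) [Fintype V] (G : SimpleGraph V) (C : Set V),
      IsCPNetwork G C α β γ → ∀ n s e b : ℕ, Fintype.card V = n → 2 ≤ n → b = 2 * e + 7 →
      Computes G (b * Nat.clog 2 n) (K * (s * s + s + 2)) (fun v => v)
        (fun (a : SparseInput V n s e) => initialRows a.A a.B a.σA a.σB) (fun v => v)
        (fun a v => (a.A * a.B) (a.σB v)) := by
  classical
  obtain ⟨K, hK⟩ := exists_exchange_time α β γ
  refine ⟨5 * K, ?_⟩
  intro V _ G C hG n s e b hV hn hb
  have : Nonempty V := by
    rw [← Fintype.card_pos_iff]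
    omega
  -- A bijection known to all nodes puts `v` in charge of the index `idx v`, independently of the
  -- input.
  have idx : V ≃ Fin n := Fintype.equivFinOfCardEq hV
  have hn1 : (1 : ℤ) ≤ n := by exact_mod_cast (by omega : 1 ≤ n)
  have hpow : ∀ m ≤ 2 * e + 1, (n : ℤ) ^ m ≤ ((n ^ (2 * e + 1) : ℕ) : ℤ) := fun m hm => by
    push_cast
    exact pow_le_pow_right₀ hn1 hm
  have hzero : (0 : ℤ) ≤ ((n ^ (2 * e + 1) : ℕ) : ℤ) := by positivity
  have codeFin := nonempty_code (Y := Fin n) (e := e) hn hV (by simp) hb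
  have codeUnit := nonempty_code (Y := Unit) (e := e) hn hV (by simp; omega) hb
  -- One bound for all five exchanges, whose loads are at most `s`, `s`, `1`, `s * s` and `s * s`.
  let D := s * s + s + 1
  have hs : s ≤ D := by simp only [D]; nlinarith
  have hss : s * s ≤ D := by simp only [D]; nlinarith
  have hone : 1 ≤ D := by simp only [D]; omega
  let I := SparseInput V n s e
  let R : I → V → RowData n := fun a => initialRows a.A a.B a.σA a.σB
  -- the columns of `A`
  have c₁ : Computes G (b * Nat.clog 2 n) (K * (D + 1)) (fun v => v) R (fun v => v)
      (fun a v => (R a v, fun i => a.A i (idx v))) := by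
    refine hK V G C hG I (Fin n) _ _ _ _ codeFin R
      (fun a u v i => if i = a.σA u then a.A i (idx v) else 0)
      (fun u r v i => if i = r.indexA then r.rowA (idx v) else 0) _
      (fun v r m => (r, fun i => ∑ u, m u i)) D ?_ ?_ ?_ ?_ ?_
    · intro a u v i
      simp only [R, initialRows]
      split_ifs with h
      · rw [h]
      · rfl
    · intro a v
      ext1
      · rfl
      · funext i
        change a.A i (idx v) = ∑ u, if i = a.σA u then a.A i (idx v) else 0
        rw [Finset.sum_eq_single (a.σA.symm i)]
        · simp
        · intro u _ hu
          rw [if_neg]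
          rintro rfl
          simp at hu
        · simp
    · intro a u v i
      split_ifs
      · exact (a.smallA _ _).trans (hpow e (by omega))
      · simp
    · intro a u
      refine (Finset.card_le_card_of_injOn (fun p : V × Fin n => idx p.1) ?_ ?_).trans
        ((a.sparseA.row_card_le (a.σA u)).trans hs)
      · rintro ⟨v, i⟩ h
        simp only [Finset.coe_filter, Finset.mem_univ, true_and, Set.mem_ofPred_eq, ne_eq,
          ite_eq_right_iff, Classical.not_imp] at h ⊢
        rw [← h.1]
        exact h.2
      · rintro ⟨v, i⟩ h ⟨v', i'⟩ h' hh
        simp only [Finset.coe_filter, Finset.mem_univ, true_and, Set.mem_ofPred_eq, ne_eq,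
          ite_eq_right_iff, Classical.not_imp] at h h'
        exact Prod.ext (idx.injective hh) (h.1.trans h'.1.symm)
    · intro a v
      refine (Finset.card_le_card_of_injOn (fun p : V × Fin n => p.2) ?_ ?_).trans
        ((a.sparseA.col_card_le (idx v)).trans hs)
      · rintro ⟨u, i⟩ h
        simp only [Finset.coe_filter, Finset.mem_univ, true_and, Set.mem_ofPred_eq, ne_eq,
          ite_eq_right_iff, Classical.not_imp] at h ⊢
        exact h.2
      · rintro ⟨u, i⟩ h ⟨u', i'⟩ h' hh
        simp only [Finset.coe_filter, Finset.mem_univ, true_and, Set.mem_ofPred_eq, ne_eq,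
          ite_eq_right_iff, Classical.not_imp] at h h'
        exact Prod.ext (a.σA.injective (h.1.symm.trans (hh.trans h'.1))) hh
  -- the rows of `B`
  have c₂ : Computes G (b * Nat.clog 2 n) (K * (D + 1)) (fun v => v)
      (fun (a : I) v => (R a v, fun i => a.A i (idx v))) (fun v => v)
      (fun a v => ((R a v, fun i => a.A i (idx v)), a.B (idx v))) := by
    refine hK V G C hG I (Fin n) _ _ _ _ codeFin _
      (fun a u v l => if a.σB u = idx v then a.B (idx v) l else 0)
      (fun u r v l => if r.1.indexB = idx v then r.1.rowB l else 0) _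
      (fun v r m => (r, fun l => ∑ u, m u l)) D ?_ ?_ ?_ ?_ ?_
    · intro a u v l
      simp only [R, initialRows]
      split_ifs with h
      · rw [h]
      · rfl
    · intro a v
      ext1
      · rfl
      · funext l
        change a.B (idx v) l = ∑ u, if a.σB u = idx v then a.B (idx v) l else 0
        rw [Finset.sum_eq_single (a.σB.symm (idx v))]
        · simp
        · intro u _ hu
          rw [if_neg]
          intro h
          rw [← h] at hu
          simp at hu
        · simp
    · intro a u v l
      split_ifs
      · exact (a.smallB _ _).trans (hpow e (by omega))
      · simp
    · intro a u
      refine (Finset.card_le_card_of_injOn (fun p : V × Fin n => p.2) ?_ ?_).trans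
        ((a.sparseB.row_card_le (a.σB u)).trans hs)
      · rintro ⟨v, l⟩ h
        simp only [Finset.coe_filter, Finset.mem_univ, true_and, Set.mem_ofPred_eq, ne_eq,
          ite_eq_right_iff, Classical.not_imp] at h ⊢
        rw [h.1]
        exact h.2
      · rintro ⟨v, l⟩ h ⟨v', l'⟩ h' hh
        simp only [Finset.coe_filter, Finset.mem_univ, true_and, Set.mem_ofPred_eq, ne_eq,
          ite_eq_right_iff, Classical.not_imp] at h h'
        exact Prod.ext (idx.injective (h.1.symm.trans h'.1)) hh
    · intro a v
      refine (Finset.card_le_card_of_injOn (fun p : V × Fin n => p.2) ?_ ?_).trans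
        ((a.sparseB.row_card_le (idx v)).trans hs)
      · rintro ⟨u, l⟩ h
        simp only [Finset.coe_filter, Finset.mem_univ, true_and, Set.mem_ofPred_eq, ne_eq,
          ite_eq_right_iff, Classical.not_imp] at h ⊢
        exact h.2
      · rintro ⟨u, l⟩ h ⟨u', l'⟩ h' hh
        simp only [Finset.coe_filter, Finset.mem_univ, true_and, Set.mem_ofPred_eq, ne_eq,
          ite_eq_right_iff, Classical.not_imp] at h h'
        exact Prod.ext (a.σB.injective (h.1.trans h'.1.symm)) hh
  -- the nodes where the rows of the product are needed
  have c₃ : Computes G (b * Nat.clog 2 n) (K * (D + 1)) (fun v => v)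
      (fun (a : I) v => ((R a v, fun i => a.A i (idx v)), a.B (idx v))) (fun v => v)
      (fun a v => (((R a v, fun i => a.A i (idx v)), a.B (idx v)),
        fun u => (if a.σB u = idx v then 1 else 0 : ℤ))) := by
    refine hK V G C hG I Unit _ _ _ _ codeUnit _
      (fun a u v _ => if a.σB u = idx v then 1 else 0)
      (fun u r v _ => if r.1.1.indexB = idx v then 1 else 0) _
      (fun v r m => (r, fun u => m u ())) D ?_ ?_ ?_ ?_ ?_
    · intro a u v l
      rfl
    · intro a v
      rfl
    · intro a u v l
      have := hpow 0 (by omega)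
      split_ifs
      · simpa using this
      · simp
    · intro a u
      refine (Finset.card_le_one.2 ?_).trans hone
      rintro ⟨v, l⟩ h ⟨v', l'⟩ h'
      simp only [Finset.mem_filter, Finset.mem_univ, true_and, ne_eq,
          ite_eq_right_iff, Classical.not_imp] at h h'
      exact Prod.ext (idx.injective (h.1.symm.trans h'.1)) rfl
    · intro a v
      refine (Finset.card_le_one.2 ?_).trans hone
      rintro ⟨v, l⟩ h ⟨v', l'⟩ h'
      simp only [Finset.mem_filter, Finset.mem_univ, true_and, ne_eq,
          ite_eq_right_iff, Classical.not_imp] at h h'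
      exact Prod.ext (a.σB.injective (h.1.trans h'.1.symm)) rfl
  -- the products
  have c₄ : Computes G (b * Nat.clog 2 n) (K * (D + 1)) (fun v => v)
      (fun (a : I) v => (((R a v, fun i => a.A i (idx v)), a.B (idx v)),
        fun u => (if a.σB u = idx v then 1 else 0 : ℤ))) (fun v => v)
      (fun a v => ((fun u => (if a.σB u = idx v then 1 else 0 : ℤ)), (a.A * a.B) (idx v))) := by
    refine hK V G C hG I (Fin n) _ _ _ _ codeFin _
      (fun a u v l => a.A (idx v) (idx u) * a.B (idx u) l)
      (fun u r v l => r.1.1.2 (idx v) * r.1.2 l) _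
      (fun v r m => (r.2, fun l => ∑ u, m u l)) D ?_ ?_ ?_ ?_ ?_
    · intro a u v l
      rfl
    · intro a v
      ext1
      · rfl
      · funext l
        change (a.A * a.B) (idx v) l = ∑ u, a.A (idx v) (idx u) * a.B (idx u) l
        rw [Matrix.mul_apply]
        exact (Equiv.sum_comp idx fun j => a.A (idx v) j * a.B j l).symm
    · intro a u v l
      refine le_trans ?_ (hpow (e + e) (by omega))
      rw [abs_mul, pow_add]
      exact mul_le_mul (a.smallA _ _) (a.smallB _ _) (abs_nonneg _) (by positivity)
    · intro a u
      refine (Finset.card_le_card_of_injOn (fun p : V × Fin n => (idx p.1, p.2)) ?_ ?_).trans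
        ((card_col_row_pairs_le a.sparseA a.sparseB (idx u)).trans hss)
      · rintro ⟨v, l⟩ h
        simpa using h
      · rintro ⟨v, l⟩ h ⟨v', l'⟩ h' hh
        simpa using hh
    · intro a v
      refine (Finset.card_le_card_of_injOn (fun p : V × Fin n => (idx p.1, p.2)) ?_ ?_).trans
        ((card_row_pairs_le a.sparseA a.sparseB (idx v)).trans hss)
      · rintro ⟨v, l⟩ h
        simpa using h
      · rintro ⟨v, l⟩ h ⟨v', l'⟩ h' hh
        simpa using hh
  -- the rows of the product
  have c₅ : Computes G (b * Nat.clog 2 n) (K * (D + 1)) (fun v => v)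
      (fun (a : I) v => ((fun u => (if a.σB u = idx v then 1 else 0 : ℤ)),
        (a.A * a.B) (idx v))) (fun v => v) (fun a v => (a.A * a.B) (a.σB v)) := by
    refine hK V G C hG I (Fin n) _ _ _ _ codeFin _
      -- The request table acts as a mask: a finished row goes only to the node that asked for it.
      (fun a u v l => (if a.σB v = idx u then 1 else 0) * (a.A * a.B) (idx u) l)
      (fun u r v l => r.1 v * r.2 l) _
      (fun v r m => fun l => ∑ u, m u l) D ?_ ?_ ?_ ?_ ?_
    · intro a u v l
      rfl
    · intro a v
      funext l
      change (a.A * a.B) (a.σB v) l =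
        ∑ u, (if a.σB v = idx u then 1 else 0) * (a.A * a.B) (idx u) l
      rw [Finset.sum_eq_single (idx.symm (a.σB v))]
      · simp
      · intro u _ hu
        rw [if_neg, zero_mul]
        intro h
        rw [h] at hu
        simp at hu
      · simp
    · intro a u v l
      split_ifs
      · rw [one_mul]
        exact (abs_mul_apply_le a.smallA a.smallB _ _).trans (hpow _ le_rfl)
      · simp
    · intro a u
      refine (Finset.card_le_card_of_injOn (fun p : V × Fin n => p.2) ?_ ?_).trans
        ((mul_row_card_le a.sparseA a.sparseB (idx u)).trans hss)
      · rintro ⟨v, l⟩ h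
        simp only [Finset.coe_filter, Finset.mem_univ, true_and, Set.mem_ofPred_eq, ne_eq,
          ite_mul, one_mul, zero_mul, ite_eq_right_iff, Classical.not_imp] at h ⊢
        exact h.2
      · rintro ⟨v, l⟩ h ⟨v', l'⟩ h' hh
        simp only [Finset.coe_filter, Finset.mem_univ, true_and, Set.mem_ofPred_eq, ne_eq,
          ite_mul, one_mul, zero_mul, ite_eq_right_iff, Classical.not_imp] at h h'
        exact Prod.ext (a.σB.injective (h.1.trans h'.1.symm)) hh
    · intro a v
      refine (Finset.card_le_card_of_injOn (fun p : V × Fin n => p.2) ?_ ?_).trans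
        ((mul_row_card_le a.sparseA a.sparseB (a.σB v)).trans hss)
      · rintro ⟨u, l⟩ h
        simp only [Finset.coe_filter, Finset.mem_univ, true_and, Set.mem_ofPred_eq, ne_eq,
          ite_mul, one_mul, zero_mul, ite_eq_right_iff, Classical.not_imp] at h ⊢
        rw [h.1]
        exact h.2
      · rintro ⟨u, l⟩ h ⟨u', l'⟩ h' hh
        simp only [Finset.coe_filter, Finset.mem_univ, true_and, Set.mem_ofPred_eq, ne_eq,
          ite_mul, one_mul, zero_mul, ite_eq_right_iff, Classical.not_imp] at h h'
        exact Prod.ext (idx.injective (h.1.symm.trans h'.1)) hh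
  refine ((((c₁.trans c₂).trans c₃).trans c₄).trans c₅).mono (le_of_eq ?_)
  simp only [D]
  ring

theorem exists_sparse_multiplication (α : ℝ) (β γ c e a : ℕ) : ∃ b K : ℕ,
    ∀ (n : ℕ) (V : Type) [Fintype V], Fintype.card V = n →
    ∀ (G : SimpleGraph V) (C : Set V), IsCPNetwork G C α β γ → ∀ k : ℕ, 1 ≤ k →
      ∃ alg : MMAlgorithm V n b,
        MultipliesSparse alg G (c * k) e (K * k ^ 2) (1 - 1 / (n : ℝ) ^ a) := by
  obtain ⟨K, hK⟩ := exists_multiplication_time α β γ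
  refine ⟨2 * e + 7, K * (c * c + c + 2), fun n V _ hV G C hG k hk => ?_⟩
  have key : Learns G ((2 * e + 7) * Nat.clog 2 n)
      (fun (a : SparseInput V n (c * k) e) v => (a.A * a.B) (a.σB v))
      (K * (c * c + c + 2) * k ^ 2) (fun a => initialRows a.A a.B a.σA a.σB) := by
    -- For `n < 2` messages have no bits, but a node, if there is one, already holds both matrices.
    rcases lt_or_ge n 2 with hn | hn
    · have h₀ : Learns G ((2 * e + 7) * Nat.clog 2 n)
          (fun (a : SparseInput V n (c * k) e) v => (a.A * a.B) (a.σB v)) 0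
          (fun a => initialRows a.A a.B a.σA a.σB) := by
        have : Subsingleton (Fin n) := Fin.subsingleton_iff_le_one.2 (by omega)
        refine ⟨fun _ r l => ∑ j, r.rowA j * r.rowB l, fun a v => ?_⟩
        funext l
        change (a.A * a.B) (a.σB v) l = ∑ j, a.A (a.σA v) j * a.B (a.σB v) l
        rw [Matrix.mul_apply]
        refine Finset.sum_congr rfl fun j _ => ?_
        rw [Subsingleton.elim (a.σA v) (a.σB v), Subsingleton.elim (a.σB v) j]
      exact h₀.mono (Nat.zero_le _)
    · refine (hK V G C hG n (c * k) e _ hV hn rfl).learns.mono ?_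
      rw [mul_assoc K]
      refine Nat.mul_le_mul_left K ?_
      nlinarith [Nat.mul_le_mul_left c (Nat.mul_le_mul_left k hk), Nat.mul_le_mul hk hk]
  obtain ⟨alg, halg⟩ := key.exists_algorithm
  refine ⟨alg, fun A B hA hB hA' hB' σA σB => ?_⟩
  exact le_successProb alg G _ _ _
    (fun coin v => halg ⟨A, B, σA, σB, hA, hB, hA', hB'⟩ coin v) n a


/-! ## A clique with pendant nodes -/

section Pendant

/-- The nodes below `m` form a clique, and every other node `u` is attached to the node `u % m`. -/
def pendantGraph (n m : ℕ) : SimpleGraph (Fin n) :=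
  SimpleGraph.fromRel fun u v =>
    ((u : ℕ) < m ∧ (v : ℕ) < m) ∨ (m ≤ (u : ℕ) ∧ (v : ℕ) = (u : ℕ) % m)

variable {n m : ℕ}

theorem pendantGraph_adj_of_le {u v : Fin n} (hm : 0 < m) (hv : m ≤ (v : ℕ))
    (h : (pendantGraph n m).Adj u v) : (u : ℕ) = v % m := by
  obtain ⟨-, (h | h) | (h | h)⟩ := h
  · omega
  · have := Nat.mod_lt (u : ℕ) hm
    omega
  · omega
  · exact h.2

/-- The pendant nodes of `v` agree modulo `m` and are told apart by quotients at most `m + 2`. So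
there are at most `m + 3 ≤ 4 * m` of them, against inner degree plus one at least `m`. The other two
axioms need a single round along direct edges. -/
theorem pendantGraph_isCPNetwork (hm : 0 < m) (hmn : m ≤ n) (hnm : n ≤ m * m + 2 * m) :
    IsCPNetwork (pendantGraph n m) {v | (v : ℕ) < m} 4 1 1 := by
  classical
  refine ⟨?_, ?_, ?_⟩
  · intro v hv
    have hv' : (v : ℕ) < m := hv
    have hout : ((pendantGraph n m).neighborSet v \ {v | (v : ℕ) < m}).ncard ≤ 4 * m := by
      have hfin : ((pendantGraph n m).neighborSet v \ {v | (v : ℕ) < m}).ncard ≤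
          (Set.Iio (m + 3)).ncard := by
        refine Set.ncard_le_ncard_of_injOn (fun u : Fin n => (u : ℕ) / m) ?_ ?_
          (Set.finite_Iio (m + 3))
        · intro u _
          have h1 : (u : ℕ) / m ≤ (m * m + 2 * m) / m := Nat.div_le_div_right (u.2.le.trans hnm)
          rw [show m * m + 2 * m = m * (m + 2) by ring, Nat.mul_div_cancel_left _ hm] at h1
          simp only [Set.mem_Iio]
          omega
        · intro u hu u' hu' h
          simp only at h
          have h1 := pendantGraph_adj_of_le hm (not_lt.1 hu.2) hu.1
          have h2 := pendantGraph_adj_of_le hm (not_lt.1 hu'.2) hu'.1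
          refine Fin.ext ?_
          rw [← Nat.div_add_mod (u : ℕ) m, ← Nat.div_add_mod (u' : ℕ) m, ← h1, ← h2, h]
      have h3 : (Set.Iio (m + 3)).ncard = m + 3 := by
        rw [Set.ncard_eq_toFinset_card']
        simp
      omega
    have hin : m ≤ ((pendantGraph n m).neighborSet v ∩ {v | (v : ℕ) < m}).ncard + 1 := by
      have h1 : m = (Set.range (Fin.castLE hmn)).ncard := by
        rw [← Set.image_univ, Set.ncard_image_of_injective _ (Fin.castLE_injective hmn),
          Set.ncard_univ, Nat.card_eq_fintype_card, Fintype.card_fin]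
      have h2 : Set.range (Fin.castLE hmn) ⊆
          insert v ((pendantGraph n m).neighborSet v ∩ {v | (v : ℕ) < m}) := by
        rintro _ ⟨u, rfl⟩
        by_cases hu : v = Fin.castLE hmn u
        · exact .inl hu.symm
        · exact .inr ⟨⟨hu, .inl (.inl ⟨hv', u.2⟩)⟩, u.2⟩
      have h3 := (Set.ncard_le_ncard h2).trans (Set.ncard_insert_le _ _)
      rwa [← h1] at h3
    rw [div_le_iff₀ (by positivity)]
    exact_mod_cast hout.trans (Nat.mul_le_mul_left 4 hin)
  · refine ⟨fun p t => if t = 0 then p.1.1 else p.1.2, fun p => rfl, fun p => rfl, ?_, ?_⟩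
    · intro p t ht
      obtain rfl : t = 0 := by omega
      refine .inr ⟨fun h => p.2 (Subtype.ext h), .inl (.inl ⟨p.1.1.2, p.1.2.2⟩)⟩
    · intro p p' t ht h1 h2 _
      obtain rfl : t = 0 := by omega
      exact Subtype.ext (Prod.ext h1 h2)
  · have hlt : ∀ v : Fin n, (v : ℕ) % m < n := fun v => (Nat.mod_lt _ hm).trans_le hmn
    refine ⟨fun v t => if t = 0 then v.1 else ⟨v.1 % m, hlt v⟩, fun v => rfl,
      fun v => Nat.mod_lt _ hm, ?_, ?_⟩
    · intro v t ht
      obtain rfl : t = 0 := by omega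
      have hv : m ≤ (v.1 : ℕ) := not_lt.1 v.2
      refine .inr ⟨fun h => ?_, .inl (.inr ⟨hv, rfl⟩)⟩
      have h1 : (v.1 : ℕ) = v.1 % m := congrArg Fin.val h
      have := Nat.mod_lt (v.1 : ℕ) hm
      omega
    · intro v v' t ht h1 _ _
      obtain rfl : t = 0 := by omega
      exact Subtype.ext h1

end Pendant

/-! ## The information received by a node with a single neighbour -/

section Information

variable {V I O F : Type} {w : ℕ} {G : SimpleGraph V}

/-- With the seeds fixed, a node with one neighbour depends on the rest of the network only through
what this neighbour sends to it. -/
theorem run_eq_of_transcript_eq (alg : CongestAlgorithm V I O w) {x y : V}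
    (hxy : ∀ u, G.Adj u x → u = y) (coin : V → alg.Coin) {i i' : V → I} (hi : i x = i' x) {T : ℕ}
    (h : ∀ t < T, alg.send y (alg.run G i coin t y) x = alg.send y (alg.run G i' coin t y) x) :
    alg.run G i coin T x = alg.run G i' coin T x := by
  induction T with
  | zero => simp only [CongestAlgorithm.run, hi]
  | succ T ih =>
    simp only [CongestAlgorithm.run]
    rw [ih fun t ht => h t (ht.trans (Nat.lt_succ_self T))]
    congr 1
    funext u
    split_ifs with hu
    · rw [hxy u hu]
      exact h T (Nat.lt_succ_self T)
    · rfl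

open Classical in
-- Instances answered correctly have distinct transcripts, and each round has `2 ^ w + 1` possible
-- messages, silence included.
theorem card_correct_le [Fintype F] (alg : CongestAlgorithm V I O w) {x y : V}
    (hxy : ∀ u, G.Adj u x → u = y) (coin : V → alg.Coin) {input : F → V → I}
    (hinput : ∀ f f', input f x = input f' x) {target : F → O}
    (htarget : Function.Injective target) (T : ℕ) :
    (Finset.univ.filter fun f => alg.output x (alg.run G (input f) coin T x) = target f).card ≤
      (2 ^ w + 1) ^ T := by
  have hcard : Fintype.card (Fin T → Message w) = (2 ^ w + 1) ^ T := by simp [Message]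
  rw [← hcard, ← Finset.card_univ]
  refine Finset.card_le_card_of_injOn
    (fun f t => alg.send y (alg.run G (input f) coin t y) x) (fun _ _ => Finset.mem_univ _) ?_
  intro f hf f' hf' h
  refine htarget ?_
  rw [← (Finset.mem_filter.1 hf).2, ← (Finset.mem_filter.1 hf').2]
  congr 1
  exact run_eq_of_transcript_eq alg hxy coin (hinput f f') fun t ht => congrFun h ⟨t, ht⟩

/-- A node with a single neighbour cannot learn too much in `T` rounds. -/
theorem card_le_of_half_le_successProb [Finite V] [Fintype F] (alg : CongestAlgorithm V I O w)
    {x y : V} (hxy : ∀ u, G.Adj u x → u = y) {input : F → V → I}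
    (hinput : ∀ f f', input f x = input f' x) {target : F → V → O}
    (htarget : Function.Injective fun f => target f x) (T : ℕ)
    (h : ∀ f, 1 / 2 ≤ alg.successProb G (input f) (target f) T) :
    Fintype.card F ≤ 2 * (2 ^ w + 1) ^ T := by
  classical
  have := alg.finiteCoin
  have := alg.nonemptyCoin
  have := Fintype.ofFinite (V → alg.Coin)
  let good : F → (V → alg.Coin) → Prop := fun f coin =>
    alg.output x (alg.run G (input f) coin T x) = target f x
  have h₁ : ∀ f, Fintype.card (V → alg.Coin) ≤
      2 * (Finset.univ.filter fun coin => good f coin).card := by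
    intro f
    have hf := h f
    have hpos : (0 : ℝ) < (Nat.card (V → alg.Coin) : ℝ) := Nat.cast_pos.2 Nat.card_pos
    rw [CongestAlgorithm.successProb, le_div_iff₀ hpos, Nat.card_eq_fintype_card,
      Nat.card_eq_fintype_card, Fintype.card_subtype] at hf
    have hle : (Finset.univ.filter fun coin : V → alg.Coin =>
        ∀ v, alg.output v (alg.run G (input f) coin T v) = target f v).card ≤
        (Finset.univ.filter fun coin => good f coin).card :=
      Finset.card_le_card fun coin hc => by
        rw [Finset.mem_filter] at hc ⊢
        exact ⟨hc.1, hc.2 x⟩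
    have hle' : ((Finset.univ.filter fun coin : V → alg.Coin =>
        ∀ v, alg.output v (alg.run G (input f) coin T v) = target f v).card : ℝ) ≤
        ((Finset.univ.filter fun coin => good f coin).card : ℝ) := Nat.cast_le.2 hle
    have : (Fintype.card (V → alg.Coin) : ℝ) ≤
        2 * ((Finset.univ.filter fun coin => good f coin).card : ℝ) := by linarith
    exact_mod_cast this
  -- Double counting of the pairs of an instance and a seed assignment giving a correct answer at
  -- `x`; some seeds must work for at least half of the instances.
  have h₂ : ∑ f, (Finset.univ.filter fun coin => good f coin).card =
      ∑ coin, (Finset.univ.filter fun f => good f coin).card :=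
    Finset.sum_card_bipartiteAbove_eq_sum_card_bipartiteBelow good
  have h₃ : Fintype.card F * Fintype.card (V → alg.Coin) ≤
      2 * (Fintype.card (V → alg.Coin) * (2 ^ w + 1) ^ T) := by
    calc _ = ∑ _f : F, Fintype.card (V → alg.Coin) := by simp
      _ ≤ ∑ f, 2 * (Finset.univ.filter fun coin => good f coin).card :=
          Finset.sum_le_sum fun f _ => h₁ f
      _ = 2 * ∑ coin, (Finset.univ.filter fun f => good f coin).card := by
          rw [← Finset.mul_sum, h₂]
      _ ≤ 2 * ∑ _coin : V → alg.Coin, (2 ^ w + 1) ^ T :=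
          Nat.mul_le_mul_left 2 (Finset.sum_le_sum fun coin _ =>
            card_correct_le alg hxy coin hinput htarget T)
      _ = _ := by simp
  have hpos : 0 < Fintype.card (V → alg.Coin) := Fintype.card_pos
  refine Nat.le_of_mul_le_mul_right (h₃.trans (le_of_eq ?_)) hpos
  ring

end Information

/-! ## A row of the product with many possible values -/

section HardInputs

/-- The first row has ones in the columns `1, …, k`. -/
def rowSelector (n k : ℕ) : Matrix (Fin n) (Fin n) ℤ := fun i j =>
  if (i : ℕ) = 0 ∧ 1 ≤ (j : ℕ) ∧ (j : ℕ) ≤ k then 1 else 0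

/-- The values `f q r` are in the row `q + 1` and the column `q * k + r`. -/
def scatter (n k : ℕ) (f : Fin k × Fin k → Fin (n + 1)) : Matrix (Fin n) (Fin n) ℤ := fun i l =>
  if h : (l : ℕ) / k < k ∧ 0 < k then
    if (i : ℕ) = l / k + 1 then (f (⟨l / k, h.1⟩, ⟨l % k, Nat.mod_lt _ h.2⟩) : ℕ) else 0
  else 0

variable {n k e : ℕ}

theorem rowSelector_isSparse (hk : 1 ≤ k) : IsSparse (rowSelector n k) k := by
  constructor
  · intro i
    have h : {j | rowSelector n k i j ≠ 0}.ncard ≤ (Set.Iio k).ncard := by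
      refine Set.ncard_le_ncard_of_injOn (fun j : Fin n => (j : ℕ) - 1) ?_ ?_ (Set.finite_Iio k)
      · intro j hj
        have hj' : (i : ℕ) = 0 ∧ 1 ≤ (j : ℕ) ∧ (j : ℕ) ≤ k := by
          by_contra hn
          exact hj (if_neg hn)
        simp only [Set.mem_Iio]
        omega
      · intro j hj j' hj' h
        have h1 : (i : ℕ) = 0 ∧ 1 ≤ (j : ℕ) ∧ (j : ℕ) ≤ k := by
          by_contra hn
          exact hj (if_neg hn)
        have h2 : (i : ℕ) = 0 ∧ 1 ≤ (j' : ℕ) ∧ (j' : ℕ) ≤ k := by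
          by_contra hn
          exact hj' (if_neg hn)
        simp only at h
        exact Fin.ext (by omega)
    rw [Set.ncard_eq_toFinset_card' (Set.Iio k)] at h
    simpa using h
  · intro j
    refine ((Set.ncard_le_one (Set.toFinite _)).2 ?_).trans hk
    intro i hi i' hi'
    have h1 : (i : ℕ) = 0 := by
      by_contra hn
      exact hi (if_neg fun h => hn h.1)
    have h2 : (i' : ℕ) = 0 := by
      by_contra hn
      exact hi' (if_neg fun h => hn h.1)
    exact Fin.ext (h1.trans h2.symm)

theorem rowSelector_hasSmallEntries (hn : 1 ≤ n) : HasSmallEntries (rowSelector n k) e := by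
  intro i j
  have : (1 : ℤ) ≤ (n : ℤ) ^ e := one_le_pow₀ (by exact_mod_cast hn)
  simp only [rowSelector]
  split_ifs
  · rwa [abs_one]
  · rw [abs_zero]
    omega

theorem eq_of_scatter_ne_zero {f : Fin k × Fin k → Fin (n + 1)} {i l : Fin n}
    (h : scatter n k f i l ≠ 0) : (i : ℕ) = l / k + 1 ∧ 0 < k := by
  simp only [scatter] at h
  split_ifs at h with h1 h2
  · exact ⟨h2, h1.2⟩
  · exact absurd rfl h
  · exact absurd rfl h

theorem scatter_isSparse (hk : 1 ≤ k) (f : Fin k × Fin k → Fin (n + 1)) :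
    IsSparse (scatter n k f) k := by
  constructor
  · intro i
    have h : {l | scatter n k f i l ≠ 0}.ncard ≤ (Set.Iio k).ncard := by
      refine Set.ncard_le_ncard_of_injOn (fun l : Fin n => (l : ℕ) % k) ?_ ?_ (Set.finite_Iio k)
      · intro l _
        exact Nat.mod_lt _ hk
      · intro l hl l' hl' h
        have h1 := (eq_of_scatter_ne_zero hl).1
        have h2 := (eq_of_scatter_ne_zero hl').1
        simp only at h
        refine Fin.ext ?_
        rw [← Nat.div_add_mod (l : ℕ) k, ← Nat.div_add_mod (l' : ℕ) k, h,
          show (l : ℕ) / k = (l' : ℕ) / k by omega]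
    rw [Set.ncard_eq_toFinset_card' (Set.Iio k)] at h
    simpa using h
  · intro l
    refine ((Set.ncard_le_one (Set.toFinite _)).2 ?_).trans hk
    intro i hi i' hi'
    exact Fin.ext ((eq_of_scatter_ne_zero hi).1.trans (eq_of_scatter_ne_zero hi').1.symm)

theorem scatter_hasSmallEntries (hn : 1 ≤ n) (he : 1 ≤ e) (f : Fin k × Fin k → Fin (n + 1)) :
    HasSmallEntries (scatter n k f) e := by
  intro i l
  have hn' : (1 : ℤ) ≤ n := by exact_mod_cast hn
  have h1 : (n : ℤ) ≤ (n : ℤ) ^ e := le_self_pow₀ hn' (by omega)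
  simp only [scatter]
  split_ifs with h2
  · rw [abs_of_nonneg (by positivity)]
    refine le_trans ?_ h1
    exact_mod_cast Nat.lt_succ_iff.1 (f _).2
  · rw [abs_zero]
    omega
  · rw [abs_zero]
    omega

/-- The first row of the product adds `k` rows supported on disjoint blocks of `k` columns, so all
`k ^ 2` values can be read off from it. -/
theorem rowSelector_mul_scatter (hkn : k + 1 ≤ n) (hk : k ^ 2 ≤ n)
    (f : Fin k × Fin k → Fin (n + 1)) (p : Fin k × Fin k) :
    (rowSelector n k * scatter n k f) ⟨0, by omega⟩
      ⟨p.1 * k + p.2, by nlinarith [p.1.2, p.2.2, Nat.mul_le_mul_right k (Nat.succ_le_of_lt p.1.2)]⟩ =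
        (f p : ℕ) := by
  have hk0 : 0 < k := p.1.pos
  have hdiv : (p.1 * k + p.2 : ℕ) / k = p.1 := by
    rw [Nat.mul_comm, Nat.mul_add_div hk0, Nat.div_eq_of_lt p.2.2, Nat.add_zero]
  have hmod : (p.1 * k + p.2 : ℕ) % k = p.2 := by
    rw [Nat.mul_comm, Nat.mul_add_mod, Nat.mod_eq_of_lt p.2.2]
  have hp := p.1.2
  rw [Matrix.mul_apply, Finset.sum_eq_single ⟨(p.1 : ℕ) + 1, by omega⟩]
  · have h1 : rowSelector n k ⟨0, by omega⟩ ⟨(p.1 : ℕ) + 1, by omega⟩ = 1 :=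
      if_pos ⟨rfl, by simp, by simp only; omega⟩
    rw [h1, one_mul]
    simp only [scatter, hdiv, hmod]
    rw [dif_pos ⟨p.1.2, hk0⟩, if_pos trivial]
  · intro j _ hj
    by_contra hne
    have h1 := (eq_of_scatter_ne_zero (right_ne_zero_of_mul hne)).1
    simp only [hdiv] at h1
    exact hj (Fin.ext h1)
  · intro hn
    exact absurd (Finset.mem_univ _) hn

end HardInputs

/-! ### The lower bound. -/

theorem two_pow_clog_le {n : ℕ} (hn : 2 ≤ n) : 2 ^ Nat.clog 2 n ≤ (n + 1) ^ 2 := by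
  have h1 := Nat.pow_pred_clog_lt_self (b := 2) (by norm_num) (x := n) (by omega)
  have h2 : 0 < Nat.clog 2 n := Nat.clog_pos (by norm_num) hn
  obtain ⟨d, hd⟩ := Nat.exists_eq_succ_of_ne_zero h2.ne'
  rw [hd] at h1 ⊢
  rw [Nat.pred_succ] at h1
  rw [Nat.pow_succ]
  nlinarith

theorem sparse_multiplication_lower_bound : ∃ (α : ℝ) (β γ : ℕ), ∀ b : ℕ, ∃ δ : ℝ, 0 < δ ∧
    ∀ n : ℕ, 2 ≤ n →
    ∃ (G : SimpleGraph (Fin n)) (C : Set (Fin n)), IsCPNetwork G C α β γ ∧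
      ∀ k e : ℕ, 1 ≤ k → k ^ 2 ≤ n → 1 ≤ e →
      ∀ (alg : MMAlgorithm (Fin n) n b) (T : ℕ),
        MultipliesSparse alg G k e T (1 / 2) → δ * (k : ℝ) ^ 2 ≤ (T : ℝ) := by
  refine ⟨4, 1, 1, fun b => ⟨1 / (2 * b + 1), by positivity, fun n hn => ?_⟩⟩
  set m := Nat.sqrt n with hm
  have hm0 : 0 < m := Nat.sqrt_pos.2 (by omega)
  have hmn : m < n := Nat.sqrt_lt_self (by omega)
  have hnm : n ≤ m * m + 2 * m := by
    have := Nat.sqrt_le_add n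
    rw [← hm] at this
    omega
  refine ⟨pendantGraph n m, _, pendantGraph_isCPNetwork hm0 hmn.le hnm, ?_⟩
  intro k e hk hkn he alg T halg
  have hk1 : k + 1 ≤ n := by
    rcases Nat.lt_or_ge k 2 with h | h
    · omega
    · nlinarith
  let x : Fin n := ⟨n - 1, by omega⟩
  let z : Fin n := ⟨0, by omega⟩
  let y : Fin n := ⟨(n - 1) % m, (Nat.mod_lt _ hm0).trans hmn⟩
  have hxy : ∀ u, (pendantGraph n m).Adj u x → u = y := fun u hu =>
    Fin.ext (pendantGraph_adj_of_le hm0 (by simp only [x]; omega) hu)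
  -- The pendant node `x` has to output row 0 of the product. Its own input does not depend on `f`,
  -- since row 0 of `scatter n k f` is zero.
  let σ : Fin n ≃ Fin n := Equiv.swap x z
  have hσ : σ x = z := Equiv.swap_apply_left x z
  have hcard := card_le_of_half_le_successProb alg hxy
    (input := fun f => initialRows (rowSelector n k) (scatter n k f) σ σ)
    (target := fun f v => (rowSelector n k * scatter n k f) (σ v)) ?_ ?_ T ?_
  · have h1 : (n + 1) ^ k ^ 2 ≤ 2 * (n + 1) ^ ((2 * b + 1) * T) := by
      have h2 : Fintype.card (Fin k × Fin k → Fin (n + 1)) = (n + 1) ^ k ^ 2 := by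
        simp [sq]
      rw [h2] at hcard
      refine hcard.trans (Nat.mul_le_mul_left 2 ?_)
      rw [pow_mul (n + 1) (2 * b + 1) T]
      refine Nat.pow_le_pow_left ?_ T
      have h3 : 2 ^ (b * Nat.clog 2 n) ≤ (n + 1) ^ (2 * b) := by
        rw [mul_comm, pow_mul, pow_mul]
        exact Nat.pow_le_pow_left (two_pow_clog_le hn) b
      rw [pow_succ]
      have h4 : 1 ≤ (n + 1) ^ (2 * b) := Nat.one_le_pow _ _ (by omega)
      nlinarith
    -- The factor 2 is harmless, because exponents are integers and `n + 1 > 2`.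
    have h5 : k ^ 2 ≤ (2 * b + 1) * T := by
      by_contra hlt
      have h6 : (n + 1) ^ ((2 * b + 1) * T + 1) ≤ (n + 1) ^ k ^ 2 :=
        Nat.pow_le_pow_right (by omega) (by omega)
      rw [pow_succ] at h6
      have h7 : 0 < (n + 1) ^ ((2 * b + 1) * T) := Nat.pow_pos (by omega)
      nlinarith
    rw [div_mul_eq_mul_div, one_mul, div_le_iff₀ (by positivity), mul_comm]
    exact_mod_cast h5
  · intro f f'
    have hrow : ∀ f, scatter n k f z = 0 := by
      intro f
      funext l
      by_contra hne
      exact (Nat.succ_ne_zero _).symm (eq_of_scatter_ne_zero hne).1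
    simp only [initialRows, hσ, hrow]
  · intro f f' h
    funext p
    simp only [hσ] at h
    have h1 := congrFun h ⟨p.1 * k + p.2, by
      nlinarith [p.1.2, p.2.2, Nat.mul_le_mul_right k (Nat.succ_le_of_lt p.1.2)]⟩
    have h2 := rowSelector_mul_scatter hk1 hkn f p
    have h3 := rowSelector_mul_scatter hk1 hkn f' p
    have h4 : ((f p : ℕ) : ℤ) = (f' p : ℕ) := h2.symm.trans (h1.trans h3)
    exact Fin.ext (by exact_mod_cast h4)
  · intro f
    exact halg _ _ (rowSelector_isSparse hk) (scatter_isSparse hk f)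
      (rowSelector_hasSmallEntries (by omega)) (scatter_hasSmallEntries (by omega) he f) σ σ

end CorePeriphery

theorem mainTheorem7 :
    -- upper bound, on every core-periphery network
    (∀ (α : ℝ) (β γ c e a : ℕ), ∃ b K : ℕ,
      ∀ (n : ℕ) (V : Type) [Fintype V], Fintype.card V = n →
      ∀ (G : SimpleGraph V) (C : Set V), CorePeriphery.IsCPNetwork G C α β γ →
      ∀ k : ℕ, 1 ≤ k →
        ∃ alg : CorePeriphery.MMAlgorithm V n b,
          CorePeriphery.MultipliesSparse alg G (c * k) e (K * k ^ 2) (1 - 1 / (n : ℝ) ^ a)) ∧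
    -- matching lower bound, on core-periphery networks of every size
    (∃ (α : ℝ) (β γ : ℕ), ∀ b : ℕ, ∃ δ : ℝ, 0 < δ ∧
      ∀ n : ℕ, 2 ≤ n →
      ∃ (G : SimpleGraph (Fin n)) (C : Set (Fin n)), CorePeriphery.IsCPNetwork G C α β γ ∧
        ∀ k e : ℕ, 1 ≤ k → k ^ 2 ≤ n → 1 ≤ e →
        ∀ (alg : CorePeriphery.MMAlgorithm (Fin n) n b) (T : ℕ),
          CorePeriphery.MultipliesSparse alg G k e T (1 / 2) → δ * (k : ℝ) ^ 2 ≤ (T : ℝ)) :=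
  ⟨CorePeriphery.exists_sparse_multiplication, CorePeriphery.sparse_multiplication_lower_bound⟩
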